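/- Let $F$ be a computable field and let $V_\infty$ be a computable $\aleph_0$-dimensional vector space over $F$ that has a computable basis (for instance, the space of finitely nonzero sequences of elements of $F$). Let $\mathcal D$ be the set of all Turing degrees. A Turing ideal is a nonempty set $I\subseteq\mathcal D$ that is closed downwards and under joins. Let $\mathcal L$ be the lattice of all subspaces of $V_\infty$; for $\mathbf d\in\mathcal D$ let $\mathcal L_{\mathbf d}(V_\infty)$ be the sublattice of those subspaces that are computably enumerable in $\mathbf d$, and for a Turing ideal $I$ let $\mathcal L_I(V_\infty)=\bigcup_{\mathbf d\in I}\mathcal L_{\mathbf d}(V_\infty)$. Let $GSL_{\mathbf d}$ be the set of pairs $\langle\mu,\sigma\rangle$ where $\sigma$ is a field automorphism of $F$, $\mu:V_\infty\to V_\infty$ is a bijection with $\mu(\alpha u+\beta v)=\sigma(\alpha)\mu(u)+\sigma(\beta)\mu(v)$ for all $\alpha,\beta\in F$ and $u,v\in V_\infty$, and both $\mu$ and $\sigma$ are computable in $\mathbf d$. For every Turing ideal $I$ and every $\mathbf d\in\mathcal D$, each automorphism of $\mathcal L_I(V_\infty)$, and each automorphism of $\mathcal L_{\mathbf d}(V_\infty)$,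 extends to a unique automorphism of $\mathcal L$. If the automorphisms of these sublattices are identified with their extensions to $\mathcal L$, then the following hold. (a) $Aut(\mathcal L_I(V_\infty))=\bigcup_{\mathbf d\in I}Aut(\mathcal L_{\mathbf d}(V_\infty))$ for every Turing ideal $I$. (b) $Aut(\mathcal L)=\bigcup_{\mathbf d\in\mathcal D}Aut(\mathcal L_{\mathbf d}(V_\infty))$. In particular, for every Turing ideal $I$ and every automorphism $\Phi$ of $\mathcal L_I(V_\infty)$ there are $\mathbf d\in I$ and $\langle\mu,\sigma\rangle\in GSL_{\mathbf d}$ such that $\Phi(W)=\mu(W)$ for all $W\in\mathcal L_I(V_\infty)$; and for every automorphism $\Phi$ of $\mathcal L$ there are $\mathbf d\in\mathcal D$ and $\langle\mu,\sigma\rangle\in GSL_{\mathbf d}$ such that $\Phi(W)=\mu(W)$ for all $W\in\mathcal L$. -/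

import Mathlib

open Computability

namespace TuringAut

/-! ### Oracle computability -/

section ComputableIn

variable {α β γ : Type*} [Primcodable α] [Primcodable β] [Primcodable γ] {O : Set (ℕ →. ℕ)}

theorem computableIn_comp {f : β → γ} {g : α → β} (hf : ComputableIn O f)
    (hg : ComputableIn O g) : ComputableIn O (fun a => f (g a)) := by
  refine Nat.RecursiveIn.of_eq (Nat.RecursiveIn.comp hf hg) fun n => ?_
  cases (Encodable.decode n : Option α) <;> simp

theorem computableIn_pair {f : α → β} {g : α → γ} (hf : ComputableIn O f)
    (hg : ComputableIn O g) : ComputableIn O (fun a => (f a, g a)) := by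
  refine Nat.RecursiveIn.of_eq (Nat.RecursiveIn.pair hf hg) fun n => ?_
  cases (Encodable.decode n : Option α) <;> simp [Seq.seq]

end ComputableIn

/-! ### Turing degrees of sets of natural numbers -/

/-- A set of natural numbers, used as an oracle (a type of its own, because sets of natural numbers
are ordered by Turing reducibility here and not by inclusion). -/
structure OracleSet where
  set : Set ℕ

/-- The characteristic function of a set, as a total oracle. -/
noncomputable def chi (A : OracleSet) : ℕ →. ℕ :=
  open Classical in fun n => Part.some (if n ∈ A.set then 1 else 0)

/-- `A ≤ B` means that `A` is Turing reducible to `B`. -/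
instance : Preorder OracleSet where
  le A B := chi A ≤ᵀ chi B
  le_refl A := TuringReducible.refl (chi A)
  le_trans _ _ _ h₁ h₂ := TuringReducible.trans h₁ h₂

/-- The Turing degrees: classes of sets that are Turing reducible to each other. -/
abbrev Degree : Type := Antisymmetrization OracleSet (· ≤ ·)

/-- The degree of a set. -/
def deg (A : OracleSet) : Degree := toAntisymmetrization (· ≤ ·) A

/-- The join `{2n : n ∈ A} ∪ {2n + 1 : n ∈ B}`. -/
def join (A B : OracleSet) : OracleSet :=
  ⟨{m | (∃ n ∈ A.set, m = 2 * n) ∨ (∃ n ∈ B.set, m = 2 * n + 1)}⟩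

theorem chi_join_even (A B : OracleSet) (n : ℕ) : chi (join A B) (2 * n) = chi A n := by
  have : 2 * n ∈ (join A B).set ↔ n ∈ A.set := by
    constructor
    · rintro (⟨m, h, hm⟩ | ⟨m, _, hm⟩)
      · obtain rfl : n = m := by omega
        exact h
      · omega
    · exact fun h => Or.inl ⟨n, h, rfl⟩
  classical exact congrArg Part.some (if_congr this rfl rfl)

theorem chi_join_odd (A B : OracleSet) (n : ℕ) : chi (join A B) (2 * n + 1) = chi B n := by
  have : 2 * n + 1 ∈ (join A B).set ↔ n ∈ B.set := by
    constructor
    · rintro (⟨m, _, hm⟩ | ⟨m, h, hm⟩)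
      · omega
      · obtain rfl : n = m := by omega
        exact h
    · exact fun h => Or.inr ⟨n, h, rfl⟩
  classical exact congrArg Part.some (if_congr this rfl rfl)

theorem le_join_left (A B : OracleSet) : A ≤ join A B := by
  have h2 : Nat.RecursiveIn {chi (join A B)} (fun n => Part.some (2 * n)) :=
    RecursiveIn.iff_nat.1
      (Primrec.nat_mul.comp (Primrec.const 2) Primrec.id).computableIn
  have h1 : Nat.RecursiveIn {chi (join A B)} (chi (join A B)) := .oracle _ (Set.mem_singleton _)
  refine RecursiveIn.iff_nat.2 ((Nat.RecursiveIn.comp h1 h2).of_eq fun n => ?_)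
  exact (Part.bind_some _ _).trans (chi_join_even A B n)

theorem le_join_right (A B : OracleSet) : B ≤ join A B := by
  have h2 : Nat.RecursiveIn {chi (join A B)} (fun n => Part.some (2 * n + 1)) :=
    RecursiveIn.iff_nat.1
      (Primrec.succ.comp (Primrec.nat_mul.comp (Primrec.const 2) Primrec.id)).computableIn
  have h1 : Nat.RecursiveIn {chi (join A B)} (chi (join A B)) := .oracle _ (Set.mem_singleton _)
  refine RecursiveIn.iff_nat.2 ((Nat.RecursiveIn.comp h1 h2).of_eq fun n => ?_)
  exact (Part.bind_some _ _).trans (chi_join_odd A B n)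

theorem join_le {A B C : OracleSet} (hA : A ≤ C) (hB : B ≤ C) : join A B ≤ C := by
  classical
  have conv : ∀ D : OracleSet, D ≤ C → ComputableIn {chi C}
      (fun n : ℕ => if n ∈ D.set then 1 else 0) := fun D h => h
  have hdiv : ComputableIn {chi C} (fun n : ℕ => n / 2) :=
    (Primrec.nat_div.comp Primrec.id (Primrec.const 2)).computableIn
  have hsel : ComputableIn {chi C}
      (fun p : ℕ × ℕ × ℕ => if p.1 % 2 = 0 then p.2.1 else p.2.2) :=
    (Primrec.ite (Primrec.eq.comp (Primrec.nat_mod.comp Primrec.fst (Primrec.const 2))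
      (Primrec.const 0)) (Primrec.fst.comp Primrec.snd)
      (Primrec.snd.comp Primrec.snd)).computableIn
  have key := computableIn_comp hsel (computableIn_pair ComputableIn.id
    (computableIn_pair (computableIn_comp (conv A hA) hdiv)
      (computableIn_comp (conv B hB) hdiv)))
  refine RecursiveIn.of_eq key fun n => ?_
  rcases Nat.even_or_odd' n with ⟨k, rfl | rfl⟩
  · rw [chi_join_even]; simp [chi]
  · have h1 : (2 * k + 1) / 2 = k := by omega
    have h2 : (2 * k + 1) % 2 = 1 := by omega
    rw [chi_join_odd]; simp [chi, h1, h2]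

instance : SemilatticeSup Degree where
  sup := Quotient.map₂ join fun _ _ h _ _ h' =>
    ⟨join_le (h.1.trans (le_join_left _ _)) (h'.1.trans (le_join_right _ _)),
      join_le (h.2.trans (le_join_left _ _)) (h'.2.trans (le_join_right _ _))⟩
  le_sup_left a b := Quotient.inductionOn₂ a b fun A B => le_join_left A B
  le_sup_right a b := Quotient.inductionOn₂ a b fun A B => le_join_right A B
  sup_le a b c := Quotient.inductionOn₃ a b c fun _ _ _ h h' => join_le h h'

/-- A Turing ideal: a nonempty set of degrees, closed downwards and under joins. -/
structure TuringIdeal where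
  carrier : Set Degree
  nonempty : carrier.Nonempty
  lower : ∀ a ∈ carrier, ∀ b, b ≤ a → b ∈ carrier
  sup_mem : ∀ a ∈ carrier, ∀ b ∈ carrier, a ⊔ b ∈ carrier

instance : Membership Degree TuringIdeal where
  mem I d := d ∈ I.carrier

/-! ### Functions computable in a degree and sets enumerable in a degree -/

/-- The total function `f` is computable in (some, equivalently every) set of degree `d`. -/
def DComputable {α β : Type*} [Primcodable α] [Primcodable β] (d : Degree) (f : α → β) : Prop :=
  ∃ D : OracleSet, deg D = d ∧ ComputableIn {chi D} f

/-- The set `S` is empty or the range of a `d`-computable sequence. -/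
def DEnumerable {α : Type*} [Primcodable α] (d : Degree) (S : Set α) : Prop :=
  S = ∅ ∨ ∃ f : ℕ → α, DComputable d f ∧ Set.range f = S

theorem DComputable.exists_rep {α β : Type*} [Primcodable α] [Primcodable β] {d : Degree}
    {f : α → β} (h : DComputable d f) {D : OracleSet} (hD : d ≤ deg D) :
    ComputableIn {chi D} f := by
  obtain ⟨E, rfl, hE⟩ := h
  have hED : E ≤ D := hD
  exact RecursiveIn.subst hE fun g hg => by
    obtain rfl : g = chi E := hg
    exact hED

theorem DComputable.mono {α β : Type*} [Primcodable α] [Primcodable β] {d e : Degree}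
    {f : α → β} (h : DComputable d f) (hde : d ≤ e) : DComputable e f := by
  obtain ⟨D, rfl⟩ : ∃ D, deg D = e := Quotient.exists_rep e
  exact ⟨D, rfl, h.exists_rep hde⟩

theorem DEnumerable.mono {α : Type*} [Primcodable α] {d e : Degree} {S : Set α}
    (h : DEnumerable d S) (hde : d ≤ e) : DEnumerable e S :=
  h.imp id fun ⟨f, hf, hS⟩ => ⟨f, hf.mono hde, hS⟩

/-! ### Computable vector spaces and their lattices of subspaces -/

/-- The field operations of the (coded) field `F` are computable. -/
structure IsComputableField (F : Type*) [Field F] [Primcodable F] : Prop where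
  add : Computable₂ (fun a b : F => a + b)
  mul : Computable₂ (fun a b : F => a * b)

/-- `V` is a coded vector space of dimension `ℵ₀` over `F` with computable operations and with a
computable basis `v₀, v₁, …`. -/
structure IsComputableVectorSpace (F V : Type*) [Field F] [Primcodable F] [AddCommGroup V]
    [Module F V] [Primcodable V] : Prop where
  add : Computable₂ (fun u v : V => u + v)
  smul : Computable₂ (fun (a : F) (v : V) => a • v)
  basis : ∃ b : Module.Basis ℕ F V, Computable (fun n : ℕ => b n)

theorem DEnumerable.inf {F V : Type*} [Field F] [AddCommGroup V] [Module F V] [Primcodable V]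
    {d : Degree} {U W : Submodule F V}
    (hU : DEnumerable d (U : Set V)) (hW : DEnumerable d (W : Set V)) :
    DEnumerable d ((U ⊓ W : Submodule F V) : Set V) := by
  classical
  obtain ⟨D, rfl⟩ : ∃ D, deg D = d := Quotient.exists_rep d
  obtain hU | ⟨f, hf, hU⟩ := hU
  · exact absurd hU U.nonempty.ne_empty
  obtain hW | ⟨g, hg, hW⟩ := hW
  · exact absurd hW W.nonempty.ne_empty
  have hsel : ComputableIn {chi D} (fun p : V × V => if p.1 = p.2 then p.1 else 0) :=
    (Primrec.ite (Primrec.eq.comp Primrec.fst Primrec.snd) Primrec.fst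
      (Primrec.const 0)).computableIn
  refine Or.inr ⟨fun n => if f n.unpair.1 = g n.unpair.2 then f n.unpair.1 else 0,
    ⟨D, rfl, ?_⟩, ?_⟩
  · exact computableIn_comp hsel (computableIn_pair
      (computableIn_comp (hf.exists_rep le_rfl)
        (computableIn_comp ComputableIn.fst ComputableIn.unpair))
      (computableIn_comp (hg.exists_rep le_rfl)
        (computableIn_comp ComputableIn.snd ComputableIn.unpair)))
  · ext v
    simp only [Set.mem_range, SetLike.mem_coe, Submodule.mem_inf]
    constructor
    · rintro ⟨n, rfl⟩
      split_ifs with h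
      · exact ⟨hU.subset ⟨_, rfl⟩, h ▸ hW.subset ⟨_, rfl⟩⟩
      · exact ⟨U.zero_mem, W.zero_mem⟩
    · rintro ⟨hu, hw⟩
      obtain ⟨i, rfl⟩ := hU.symm.subset hu
      obtain ⟨j, hj⟩ := hW.symm.subset hw
      exact ⟨Nat.pair i j, by simp [hj]⟩

section Lattices

variable {F V : Type*} [Field F] [Primcodable F] [AddCommGroup V] [Module F V] [Primcodable V]

theorem DEnumerable.sup (hV : IsComputableVectorSpace F V) {d : Degree} {U W : Submodule F V}
    (hU : DEnumerable d (U : Set V)) (hW : DEnumerable d (W : Set V)) :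
    DEnumerable d ((U ⊔ W : Submodule F V) : Set V) := by
  obtain ⟨D, rfl⟩ : ∃ D, deg D = d := Quotient.exists_rep d
  obtain hU | ⟨f, hf, hU⟩ := hU
  · exact absurd hU U.nonempty.ne_empty
  obtain hW | ⟨g, hg, hW⟩ := hW
  · exact absurd hW W.nonempty.ne_empty
  have hadd : ComputableIn {chi D} (fun p : V × V => p.1 + p.2) := Computable.computableIn hV.add
  refine Or.inr ⟨fun n => f n.unpair.1 + g n.unpair.2, ⟨D, rfl, ?_⟩, ?_⟩
  · exact computableIn_comp hadd (computableIn_pair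
      (computableIn_comp (hf.exists_rep le_rfl)
        (computableIn_comp ComputableIn.fst ComputableIn.unpair))
      (computableIn_comp (hg.exists_rep le_rfl)
        (computableIn_comp ComputableIn.snd ComputableIn.unpair)))
  · ext v
    simp only [Set.mem_range, SetLike.mem_coe, Submodule.mem_sup]
    constructor
    · rintro ⟨n, rfl⟩
      exact ⟨_, hU.subset ⟨_, rfl⟩, _, hW.subset ⟨_, rfl⟩, rfl⟩
    · rintro ⟨u, hu, w, hw, rfl⟩
      obtain ⟨i, rfl⟩ := hU.symm.subset hu
      obtain ⟨j, rfl⟩ := hW.symm.subset hw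
      exact ⟨Nat.pair i j, by simp⟩

/-- The lattice of the `d`-computably enumerable subspaces of `V`. -/
def latticeOfDegree (hV : IsComputableVectorSpace F V) (d : Degree) :
    Sublattice (Submodule F V) where
  carrier := {W | DEnumerable d (W : Set V)}
  supClosed' := fun _ hU _ hW => DEnumerable.sup hV hU hW
  infClosed' := fun _ hU _ hW => DEnumerable.inf hU hW

/-- The lattice of the subspaces of `V` that are computably enumerable in some `d ∈ I`. -/
def latticeOfIdeal (hV : IsComputableVectorSpace F V) (I : TuringIdeal) :
    Sublattice (Submodule F V) where
  carrier := {W | ∃ d ∈ I, DEnumerable d (W : Set V)}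
  supClosed' := fun _ ⟨d, hd, hU⟩ _ ⟨e, he, hW⟩ => ⟨d ⊔ e, I.sup_mem d hd e he,
    DEnumerable.sup hV (hU.mono le_sup_left) (hW.mono le_sup_right)⟩
  infClosed' := fun _ ⟨d, hd, hU⟩ _ ⟨e, he, hW⟩ => ⟨d ⊔ e, I.sup_mem d hd e he,
    DEnumerable.inf (hU.mono le_sup_left) (hW.mono le_sup_right)⟩

/-- The automorphism `Φ` of the lattice of all subspaces extends the automorphism `φ` of the
sublattice `S`. -/
def Extends {S : Sublattice (Submodule F V)} (Φ : Submodule F V ≃o Submodule F V)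
    (φ : S ≃o S) : Prop :=
  ∀ W : S, Φ (W : Submodule F V) = (φ W : Submodule F V)

/-- The automorphisms of the sublattice `S`, identified with their extensions to automorphisms of
the lattice of all subspaces. -/
def autExt (S : Sublattice (Submodule F V)) : Set (Submodule F V ≃o Submodule F V) :=
  {Φ | ∃ φ : S ≃o S, Extends Φ φ}

variable (F V) in
/-- The bijective semilinear transformations `⟨μ, σ⟩` of `V` with `μ` and `σ` both computable
in `d`. -/
structure GSL (d : Degree) where
  σ : F ≃+* F
  μ : V → V
  semilinear : ∀ (a b : F) (u v : V), μ (a • u + b • v) = σ a • μ u + σ b • μ v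
  bijective : Function.Bijective μ
  computable_μ : DComputable d μ
  computable_σ : DComputable d (fun a : F => σ a)

end Lattices

end TuringAut

/-! Every lattice in question contains all lines `span F {v}`, and these are its atoms. An
automorphism therefore permutes the lines and preserves the relation that one line lies in the join
of two others. By the fundamental theorem of projective geometry (`exists_semilinear`) it is induced
by a semilinear bijection `μ` with field automorphism `σ`, which also induces an automorphism of the
full lattice. The extension is unique because a subspace is the supremum of its lines
(`orderIso_ext`).

What remains is effectivity (`computableIn_of_images`): for a lattice given by an ideal `I`, both
`μ` and `σ` are computable in a single degree of `I`. Fix a computable basis `b`. Five computably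
enumerable subspaces carry enough information: the spans of the even and of the odd basis vectors,
two graphs linking `b (2n)` to `b (2n+1)` and `b (2n+1)` to `b (2n+2)`, and a graph with
coefficients running through all of `F`. Their images are enumerable in degrees of `I`, hence all in
one join of five degrees. A linear map between complementary subspaces is computable from
enumerations of both subspaces and of the graph (`exists_computableIn_graph`). So the vectors `μ (b
n)` are generated one after another from `μ (b 0)`, `σ` is read off the fifth image, and coordinates
in `b` then give `μ` everywhere.

Conversely, a bijection computable in `e` has an inverse computable in `e`, so it preserves and
reflects enumerability in every degree above `e`. A single degree is treated as a principal ideal.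
The full lattice belongs to the ideal of all degrees, because every subspace is the range of a
sequence and every sequence is computable in some set. -/

namespace TuringAut

/-! ### Search, recursion and inverses relative to an oracle -/

section Computability

variable {α β γ : Type*} [Primcodable α] [Primcodable β] [Primcodable γ] {O : Set (ℕ →. ℕ)}

/-- Unbounded search: a zero of `f (a, ·)` can be found computably if it always exists. -/
theorem exists_computableIn_find {f : α × ℕ → ℕ} (hf : ComputableIn O f)
    (h : ∀ a, ∃ n, f (a, n) = 0) : ∃ g : α → ℕ, ComputableIn O g ∧ ∀ a, f (a, g a) = 0 := by
  classical
  refine ⟨fun a => Nat.find (h a), ?_, fun a => Nat.find_spec (h a)⟩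
  refine Nat.RecursiveIn.of_eq (Nat.RecursiveIn.rfind hf) fun n => ?_
  cases hn : (Encodable.decode n : Option α) with
  | none =>
    refine Eq.trans (b := Part.none) (Part.eq_none_iff.2 fun m hm => ?_) (by simp)
    have := Nat.rfind_spec hm
    simp [hn] at this
  | some a =>
    refine Eq.trans (b := Part.some (Nat.find (h a)))
      (Part.eq_some_iff.2 (Nat.mem_rfind.2 ⟨?_, fun {m} hm => ?_⟩)) (by simp)
    · simpa [hn] using Nat.find_spec (h a)
    · simpa [hn] using Nat.find_min (h a) hm

theorem exists_computableIn_find_prop {P : α → ℕ → Prop} [∀ a n, Decidable (P a n)]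
    (hf : ComputableIn O fun p : α × ℕ => decide (P p.1 p.2))
    (h : ∀ a, ∃ n, P a n) : ∃ g : α → ℕ, ComputableIn O g ∧ ∀ a, P a (g a) := by
  have hc : ComputableIn O (fun b : Bool => bif b then 0 else 1) :=
    (Primrec.cond Primrec.id (Primrec.const 0) (Primrec.const 1)).computableIn
  obtain ⟨g, hg, hg'⟩ := exists_computableIn_find (computableIn_comp hc hf)
    (fun a => (h a).imp fun n hn => by simp [hn])
  refine ⟨g, hg, fun a => ?_⟩
  have := hg' a
  by_contra hP
  simp [hP] at this

/-- `Nat.RecursiveIn.prec` recurses on codes with partial values. This evaluates it when the start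
is a valid code; `rec_bind_none` covers an input that decodes to nothing. -/
theorem rec_bind_some {H : ℕ → ℕ → Part ℕ} {s : β × ℕ → β}
    (hH : ∀ k x, H k (Encodable.encode x) = Part.some (Encodable.encode (s (x, k)))) (x : β)
    (m : ℕ) : (Nat.rec (Part.some (Encodable.encode x)) (fun k z => z.bind fun i => H k i) m :
      Part ℕ) = Part.some (Encodable.encode (Nat.rec x (fun k x => s (x, k)) m : β)) := by
  induction m with
  | zero => rfl
  | succ m ih => simp only [ih, Part.bind_some, hH]

theorem rec_bind_none {H : ℕ → ℕ → Part ℕ} (m : ℕ) :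
    (Nat.rec Part.none (fun k z => z.bind fun i => H k i) m : Part ℕ) = Part.none := by
  induction m with
  | zero => rfl
  | succ m ih => simp only [ih, Part.bind_none]

/-- Primitive recursion. -/
theorem computableIn_rec {s : β × ℕ → β} (hs : ComputableIn O s) :
    ComputableIn O (fun p : β × ℕ => (Nat.rec p.1 (fun k x => s (x, k)) p.2 : β)) := by
  have hid : ComputableIn O (@id β) := ComputableIn.id
  -- `prec` hands its step the code of (parameter, (counter, value)), whereas `s` takes (value,
  -- counter): the parameter is dropped and the rest is swapped.
  have hsw : Nat.RecursiveIn O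
      (fun n => Part.some (Nat.pair n.unpair.2.unpair.2 n.unpair.2.unpair.1)) := by
    refine RecursiveIn.iff_nat.1 (Primrec.computableIn (O := O)
      (f := fun n : ℕ => Nat.pair n.unpair.2.unpair.2 n.unpair.2.unpair.1) ?_)
    exact Primrec₂.natPair.comp
      (Primrec.snd.comp (Primrec.unpair.comp (Primrec.snd.comp Primrec.unpair)))
      (Primrec.fst.comp (Primrec.unpair.comp (Primrec.snd.comp Primrec.unpair)))
  refine Nat.RecursiveIn.of_eq (Nat.RecursiveIn.prec hid (Nat.RecursiveIn.comp hs hsw))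
    fun n => ?_
  cases ha : (Encodable.decode n.unpair.1 : Option β) with
  | none =>
    simp only [ha]
    refine Eq.trans (b := Part.none) ?_ (by simp [Encodable.decode_prod_val, ha])
    simpa using rec_bind_none _
  | some a =>
    simp only [ha]
    refine Eq.trans ?_ (b := Part.some (Encodable.encode
      (Nat.rec a (fun k x => s (x, k)) n.unpair.2 : β)))
      (by simp [Encodable.decode_prod_val, ha])
    simp only [Part.coe_some, Part.bind_some, Part.map_some, id_eq]
    refine rec_bind_some (fun k x => ?_) a _
    simp

/-- A standard enumeration of a nonempty coded type. -/
def enum (a : α) (n : ℕ) : α := (Encodable.decode n).getD a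

theorem enum_encode (a b : α) : enum a (Encodable.encode b) = b := by simp [enum]

theorem enum_surjective (a : α) : Function.Surjective (enum a) :=
  fun b => ⟨_, enum_encode a b⟩

theorem computableIn_enum (a : α) : ComputableIn O (enum a) :=
  (Primrec.option_getD.comp Primrec.decode (Primrec.const a)).computableIn

theorem computableIn_encode : ComputableIn O (Encodable.encode : α → ℕ) :=
  Primrec.encode.computableIn

theorem computableIn_decide_eq [DecidableEq β] {f g : α → β} (hf : ComputableIn O f)
    (hg : ComputableIn O g) : ComputableIn O fun a => decide (f a = g a) := by
  have h : Primrec fun p : β × β => decide (p.1 = p.2) := Primrec.eq.decide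
  exact computableIn_comp h.computableIn (computableIn_pair hf hg)

/-- A surjective computable function has a computable right inverse. -/
theorem exists_computableIn_rightInverse [Nonempty α] {f : α → β} (hf : ComputableIn O f)
    (h : Function.Surjective f) :
    ∃ g : β → α, ComputableIn O g ∧ Function.RightInverse g f := by
  classical
  inhabit α
  have h1 : ComputableIn O (fun p : β × ℕ => decide (f (enum default p.2) = p.1)) :=
    computableIn_decide_eq (computableIn_comp hf
      (computableIn_comp (computableIn_enum _) ComputableIn.snd)) ComputableIn.fst
  obtain ⟨g, hg, hg'⟩ := exists_computableIn_find_prop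
    (P := fun (b : β) n => f (enum default n) = b) h1 fun b => by
      obtain ⟨a, rfl⟩ := h b
      exact ⟨Encodable.encode a, by rw [enum_encode]⟩
  exact ⟨fun b => enum default (g b), computableIn_comp (computableIn_enum _) hg, hg'⟩

/-- Every function is computable in some set. -/
theorem exists_computableIn (f : α → β) : ∃ D : OracleSet, ComputableIn {chi D} f := by
  classical
  rcases isEmpty_or_nonempty α with hα | ⟨⟨a₀⟩⟩
  · refine ⟨⟨∅⟩, ?_⟩
    have h : Partrec (fun _ : α => (Part.none : Part β)) := Partrec.none
    exact RecursiveIn.of_eq h.recursiveIn fun a => isEmptyElim a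
  -- The oracle is the coded graph of `f`; a value of `f` is found by searching for its code.
  let D : OracleSet := ⟨{n | ∃ a, n = Nat.pair (Encodable.encode a) (Encodable.encode (f a))}⟩
  have hD : ComputableIn {chi D} (fun n : ℕ => if n ∈ D.set then 1 else 0) :=
    RecursiveIn.iff_nat.2 (Nat.RecursiveIn.oracle _ rfl)
  have hpair : ComputableIn {chi D} (fun p : ℕ × ℕ => Nat.pair p.1 p.2) :=
    Primrec₂.natPair.computableIn
  have h1 : ComputableIn {chi D} (fun p : α × ℕ =>
      decide ((if Nat.pair (Encodable.encode p.1) p.2 ∈ D.set then 1 else 0) = 1)) :=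
    computableIn_decide_eq (computableIn_comp hD (computableIn_comp hpair
      (computableIn_pair (computableIn_comp computableIn_encode ComputableIn.fst)
        ComputableIn.snd))) (ComputableIn.const 1)
  have key : ∀ a n, (if Nat.pair (Encodable.encode a) n ∈ D.set then 1 else 0) = 1 ↔
      n = Encodable.encode (f a) := by
    intro a n
    have : Nat.pair (Encodable.encode a) n ∈ D.set ↔ n = Encodable.encode (f a) := by
      constructor
      · rintro ⟨b, hb⟩
        obtain ⟨h, h'⟩ := Nat.pair_eq_pair.1 hb
        rw [h', Encodable.encode_injective h]
      · rintro rfl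
        exact ⟨a, rfl⟩
    simp [this]
  obtain ⟨g, hg, hg'⟩ := exists_computableIn_find_prop
    (P := fun (a : α) n => (if Nat.pair (Encodable.encode a) n ∈ D.set then 1 else 0) = 1) h1
    fun a => ⟨_, (key a _).2 rfl⟩
  refine ⟨D, RecursiveIn.of_eq (computableIn_comp (computableIn_enum (f a₀)) hg) fun a => ?_⟩
  change Part.some (enum (f a₀) (g a)) = _
  rw [(key a _).1 (hg' a), enum_encode]

end Computability

/-! ### Enumerating linear combinations -/

section Comb

variable {F V : Type*} [Field F] [AddCommGroup V] [Module F V]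

/-- The `k`-th entry of the sequence coded by `c`. -/
def entry (k c : ℕ) : ℕ := ((fun m => m.unpair.2)^[k] c).unpair.1

theorem exists_entry (n : ℕ) (t : ℕ → ℕ) : ∃ c, ∀ k < n, entry k c = t k := by
  induction n generalizing t with
  | zero => exact ⟨0, by simp⟩
  | succ n ih =>
    obtain ⟨c, hc⟩ := ih fun k => t (k + 1)
    refine ⟨Nat.pair (t 0) c, fun k hk => ?_⟩
    cases k with
    | zero => simp [entry]
    | succ k => simpa [entry] using hc k (by omega)

/-- The linear combination of `w 0, …, w (n - 1)` whose coefficients are the values of `s` at the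
entries of the sequence coded by `c`. -/
def comb (s : ℕ → F) (w : ℕ → V) (n c : ℕ) : V := ∑ k ∈ Finset.range n, s (entry k c) • w k

theorem exists_comb_eq {s : ℕ → F} (hs : Function.Surjective s) (w : ℕ → V) (n : ℕ)
    (a : ℕ → F) : ∃ c, comb s w n c = ∑ k ∈ Finset.range n, a k • w k := by
  choose t ht using hs
  obtain ⟨c, hc⟩ := exists_entry n fun k => t (a k)
  exact ⟨c, Finset.sum_congr rfl fun k hk => by rw [hc k (Finset.mem_range.1 hk), ht]⟩

theorem mem_span_range_iff_exists_sum {w : ℕ → V} {v : V} :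
    v ∈ Submodule.span F (Set.range w) ↔
      ∃ (n : ℕ) (a : ℕ → F), ∑ k ∈ Finset.range n, a k • w k = v := by
  constructor
  · intro hv
    obtain ⟨a, rfl⟩ := Finsupp.mem_span_range_iff_exists_finsupp.1 hv
    -- The bound exceeds every index in the support; beyond the support the coefficients vanish.
    refine ⟨a.support.sup id + 1, a, ?_⟩
    rw [Finsupp.sum]
    refine (Finset.sum_subset (fun k hk => ?_) fun k _ hk => ?_).symm
    · exact Finset.mem_range.2 (Nat.lt_succ_of_le (Finset.le_sup (f := id) hk))
    · simp [Finsupp.notMem_support_iff.1 hk]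
  · rintro ⟨n, a, rfl⟩
    exact Submodule.sum_mem _ fun k _ =>
      Submodule.smul_mem _ _ (Submodule.subset_span (Set.mem_range_self k))

theorem exists_comb_eq_of_mem_span {s : ℕ → F} (hs : Function.Surjective s) {w : ℕ → V} {v : V}
    (hv : v ∈ Submodule.span F (Set.range w)) : ∃ n c, comb s w n c = v := by
  obtain ⟨n, a, rfl⟩ := mem_span_range_iff_exists_sum.1 hv
  exact ⟨n, exists_comb_eq hs w n a⟩

theorem comb_mem_span (s : ℕ → F) (w : ℕ → V) (n c : ℕ) :
    comb s w n c ∈ Submodule.span F (Set.range w) :=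
  mem_span_range_iff_exists_sum.2 ⟨n, _, rfl⟩

variable [Primcodable F] [Primcodable V] {O : Set (ℕ →. ℕ)}

/-- Primitive recursion on the state (partial sum, rest of the coded coefficient sequence). -/
theorem computableIn_comb (hV : IsComputableVectorSpace F V) {s : ℕ → F} {w : ℕ → V}
    (hs : ComputableIn O s) (hw : ComputableIn O w) :
    ComputableIn O (fun p : ℕ × ℕ => comb s w p.1 p.2) := by
  have hadd : ComputableIn O (fun p : V × V => p.1 + p.2) := Computable.computableIn hV.add
  have hsmul : ComputableIn O (fun p : F × V => p.1 • p.2) := Computable.computableIn hV.smul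
  have hl : ComputableIn O (fun n : ℕ => n.unpair.1) :=
    (Primrec.fst.comp Primrec.unpair).computableIn
  have hr : ComputableIn O (fun n : ℕ => n.unpair.2) :=
    (Primrec.snd.comp Primrec.unpair).computableIn
  have hcode : ComputableIn O (fun q : (V × ℕ) × ℕ => q.1.2) :=
    (Primrec.snd.comp Primrec.fst).computableIn
  have hacc : ComputableIn O (fun q : (V × ℕ) × ℕ => q.1.1) :=
    (Primrec.fst.comp Primrec.fst).computableIn
  have hcoef := computableIn_comp hs (computableIn_comp hl hcode)
  have hvec := computableIn_comp hw (ComputableIn.snd : ComputableIn O fun q : (V × ℕ) × ℕ => q.2)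
  have hterm := computableIn_comp hsmul (computableIn_pair hcoef hvec)
  have hnext := computableIn_comp hr hcode
  have hstep : ComputableIn O (fun q : (V × ℕ) × ℕ =>
      (q.1.1 + s q.1.2.unpair.1 • w q.2, q.1.2.unpair.2)) :=
    computableIn_pair (computableIn_comp hadd (computableIn_pair hacc hterm)) hnext
  have key := computableIn_comp ComputableIn.fst (computableIn_comp (computableIn_rec hstep)
    (computableIn_pair (computableIn_pair (ComputableIn.const (0 : V)) ComputableIn.snd)
      ComputableIn.fst : ComputableIn O fun p : ℕ × ℕ => (((0 : V), p.2), p.1)))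
  refine RecursiveIn.of_eq key fun p => congrArg Part.some ?_
  obtain ⟨n, c⟩ := p
  suffices h : (Nat.rec ((0 : V), c)
      (fun k x => (x.1 + s x.2.unpair.1 • w k, x.2.unpair.2)) n : V × ℕ) =
      (comb s w n c, (fun m => m.unpair.2)^[n] c) from congrArg Prod.fst h
  induction n with
  | zero => simp [comb]
  | succ n ih =>
    simp only [ih, Function.iterate_succ_apply']
    simp [comb, entry, Finset.sum_range_succ]

theorem DEnumerable.span_range (hV : IsComputableVectorSpace F V) {d : Degree} {w : ℕ → V}
    (hw : DComputable d w) : DEnumerable d (Submodule.span F (Set.range w) : Set V) := by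
  obtain ⟨D, rfl, hw⟩ := hw
  refine Or.inr ⟨fun n => comb (enum (0 : F)) w n.unpair.1 n.unpair.2, ⟨D, rfl, ?_⟩, ?_⟩
  · have h := computableIn_comb hV (computableIn_enum (0 : F)) hw
    have h' := computableIn_comp h ComputableIn.unpair
    exact h'
  · ext v
    constructor
    · rintro ⟨n, rfl⟩
      exact comb_mem_span _ _ _ _
    · intro hv
      obtain ⟨n, c, rfl⟩ := exists_comb_eq_of_mem_span (enum_surjective (0 : F)) hv
      exact ⟨Nat.pair n c, by simp⟩

theorem DEnumerable.span_singleton (hV : IsComputableVectorSpace F V) (d : Degree) (v : V) :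
    DEnumerable d (Submodule.span F {v} : Set V) := by
  obtain ⟨D, rfl⟩ : ∃ D, deg D = d := Quotient.exists_rep d
  simpa using DEnumerable.span_range (F := F) hV (w := fun _ => v) ⟨D, rfl, ComputableIn.const v⟩

end Comb

end TuringAut

namespace TuringAut

/-! ### The fundamental theorem of projective geometry in infinite dimension -/

section Projective

open Submodule

variable {F V : Type*} [Field F] [AddCommGroup V] [Module F V]

/-- `u'` is a nonzero multiple of `T u`. -/
def Rep (F : Type*) {V : Type*} [Field F] [AddCommGroup V] [Module F V] (T : V → V) (u u' : V) :
    Prop :=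
  ∃ a : F, a ≠ 0 ∧ T u = a • u'

/-- A map on vectors that preserves and reflects membership in spans of pairs. -/
def PreservesLines (F : Type*) {V : Type*} [Field F] [AddCommGroup V] [Module F V] (T : V → V) :
    Prop :=
  ∀ u v w, u ∈ span F {v, w} ↔ T u ∈ span F {T v, T w}

theorem Rep.span_eq {T : V → V} {u u' : V} (h : Rep F T u u') :
    span F {u'} = span F {T u} := by
  obtain ⟨a, ha, h⟩ := h
  rw [h, span_singleton_smul_eq (IsUnit.mk0 a ha)]

theorem Rep.mem_span_pair_iff {T : V → V} (hT : PreservesLines F T) {u v w u' v' w' : V}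
    (hu : Rep F T u u') (hv : Rep F T v v') (hw : Rep F T w w') :
    u ∈ span F {v, w} ↔ u' ∈ span F {v', w'} := by
  rw [hT, span_insert, span_insert, hv.span_eq, hw.span_eq]
  obtain ⟨a, ha, h⟩ := hu
  rw [h, smul_mem_iff _ ha]

/-- `h` lifts the projective map induced by `T` on the kernel of the functional `c`, normalized at
a vector `e` with `c e = 1`. -/
structure NormalizedLift (T : V → V) (e : V) (c : V →ₗ[F] F) (h : V → V) : Prop where
  preserves : PreservesLines F T
  map_zero : T 0 = 0
  apply_e : c e = 1
  rep : ∀ x, c x = 0 → Rep F T x (h x)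
  rep_add : ∀ x, c x = 0 → Rep F T (e + x) (T e + h x)

/-- Since `e + x` lies in the span of `e` and `x`, `T (e + x) = a • T e + b • T x`. Neither
coefficient vanishes when `x ≠ 0`, and dividing by `a` makes the coefficient of `T e` equal to 1,
which singles out the multiple `(a⁻¹ * b) • T x`. -/
theorem exists_normalizedLift {T : V → V} (hT : PreservesLines F T) (h0 : T 0 = 0) {e : V}
    {c : V →ₗ[F] F} (hc : c e = 1) : ∃ h, NormalizedLift T e c h := by
  suffices H : ∀ x, ∃ y, c x = 0 → Rep F T x y ∧ Rep F T (e + x) (T e + y) by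
    choose h hh using H
    exact ⟨h, hT, h0, hc, fun x hx => (hh x hx).1, fun x hx => (hh x hx).2⟩
  intro x
  by_cases hcx : c x = 0
  swap
  · exact ⟨0, fun h => absurd h hcx⟩
  by_cases hx : x = 0
  · subst hx
    exact ⟨0, fun _ => ⟨⟨1, one_ne_zero, by simp [h0]⟩, ⟨1, one_ne_zero, by simp⟩⟩⟩
  have hmem : e + x ∈ span F {e, x} := mem_span_pair.2 ⟨1, 1, by simp⟩
  obtain ⟨a, b, hab⟩ := mem_span_pair.1 ((hT _ _ _).1 hmem)
  have ha : a ≠ 0 := by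
    rintro rfl
    have h1 : T (e + x) ∈ span F {T x, T x} := mem_span_pair.2 ⟨0, b, by simpa using hab⟩
    obtain ⟨p, q, hpq⟩ := mem_span_pair.1 ((hT _ _ _).2 h1)
    have := congrArg c hpq
    simp [hcx, hc] at this
  have hb : b ≠ 0 := by
    rintro rfl
    have h1 : T (e + x) ∈ span F {T e, T e} := mem_span_pair.2 ⟨a, 0, by simpa using hab⟩
    obtain ⟨p, q, hpq⟩ := mem_span_pair.1 ((hT _ _ _).2 h1)
    have h2 := congrArg c hpq
    simp only [map_add, map_smul, hc, hcx, smul_eq_mul, mul_one, add_zero] at h2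
    rw [← add_smul, h2, one_smul] at hpq
    exact hx (by simpa using hpq.symm)
  refine ⟨(a⁻¹ * b) • T x, fun _ => ⟨⟨b⁻¹ * a, by simp [ha, hb], ?_⟩, ⟨a, ha, ?_⟩⟩⟩
  · rw [smul_smul]
    field_simp
    simp
  · rw [← hab, smul_add, smul_smul, mul_inv_cancel_left₀ ha]

namespace NormalizedLift

variable {T : V → V} {e : V} {c : V →ₗ[F] F} {h : V → V} (H : NormalizedLift T e c h)
include H

theorem apply_zero : h 0 = 0 := by
  obtain ⟨a, ha, h0⟩ := H.rep 0 (by simp)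
  rw [H.map_zero] at h0
  exact (smul_eq_zero.1 h0.symm).resolve_left ha

theorem mem_iff {x y z : V} (hx : c x = 0) (hy : c y = 0) (hz : c z = 0) :
    x ∈ span F {y, z} ↔ h x ∈ span F {h y, h z} :=
  Rep.mem_span_pair_iff H.preserves (H.rep x hx) (H.rep y hy) (H.rep z hz)

theorem mem_singleton_iff {x y : V} (hx : c x = 0) (hy : c y = 0) :
    x ∈ span F {y} ↔ h x ∈ span F {h y} := by
  simpa using H.mem_iff hx hy hy

theorem ne_zero {x : V} (hx : c x = 0) (hx0 : x ≠ 0) : h x ≠ 0 := by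
  intro hh
  have := (H.mem_singleton_iff hx (LinearMap.map_zero c)).2 (by simp [hh])
  simp at this
  exact hx0 this

theorem base_notMem {x y : V} (hx : c x = 0) (hy : c y = 0) : T e ∉ span F {h x, h y} := by
  intro hmem
  have := (Rep.mem_span_pair_iff H.preserves
    (⟨1, one_ne_zero, (one_smul F _).symm⟩ : Rep F T e (T e)) (H.rep x hx)
    (H.rep y hy)).2 hmem
  obtain ⟨p, q, hpq⟩ := mem_span_pair.1 this
  have := congrArg c hpq
  simp [hx, hy, H.apply_e] at this

theorem coeff_base_eq_zero {x y : V} (hx : c x = 0) (hy : c y = 0) {α β γ : F}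
    (hs : α • T e + β • h x + γ • h y = 0) : α = 0 := by
  by_contra hα
  refine H.base_notMem hx hy ?_
  rw [← smul_mem_iff _ hα]
  refine mem_span_pair.2 ⟨-β, -γ, ?_⟩
  rw [← sub_eq_zero, ← neg_eq_zero, ← hs]
  module

/-- `T` reflects membership in spans of pairs, so the independence of `e`, `x`, `y` passes to `T e`,
`h x`, `h y`. This is the tool for comparing coefficients below. -/
theorem coeffs_eq_zero {x y : V} (hx : c x = 0) (hy : c y = 0) (hx0 : x ≠ 0)
    (hxy : y ∉ span F {x}) {α β γ : F} (hs : α • T e + β • h x + γ • h y = 0) :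
    α = 0 ∧ β = 0 ∧ γ = 0 := by
  obtain rfl := H.coeff_base_eq_zero hx hy hs
  have hγ : γ = 0 := by
    by_contra hγ
    refine hxy ((H.mem_singleton_iff hy hx).2 ?_)
    rw [← smul_mem_iff _ hγ]
    refine mem_span_singleton.2 ⟨-β, ?_⟩
    rw [← sub_eq_zero, ← neg_eq_zero, ← hs]
    module
  subst hγ
  refine ⟨rfl, ?_, rfl⟩
  simpa [H.ne_zero hx hx0] using hs

/-- The vector `e + x + y` lies in the span of `e + x` and `y` and in that of `e + y` and `x`. With
`h (x + y) = m • h x + n • h y`, the first incidence forces `m = 1` and the second `n = 1`. -/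
theorem map_add_of_notMem {x y : V} (hx : c x = 0) (hy : c y = 0) (hxy : y ∉ span F {x}) :
    h (x + y) = h x + h y := by
  by_cases hx0 : x = 0
  · simp [hx0, H.apply_zero]
  have hz : c (x + y) = 0 := by simp [hx, hy]
  have h1 : T e + h (x + y) ∈ span F {T e + h x, h y} :=
    (Rep.mem_span_pair_iff H.preserves (H.rep_add _ hz) (H.rep_add x hx) (H.rep y hy)).1
      (mem_span_pair.2 ⟨1, 1, by module⟩)
  have h2 : T e + h (x + y) ∈ span F {T e + h y, h x} :=
    (Rep.mem_span_pair_iff H.preserves (H.rep_add _ hz) (H.rep_add y hy) (H.rep x hx)).1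
      (mem_span_pair.2 ⟨1, 1, by module⟩)
  have h3 : h (x + y) ∈ span F {h x, h y} :=
    (H.mem_iff hz hx hy).1 (mem_span_pair.2 ⟨1, 1, by module⟩)
  obtain ⟨p, q, hpq⟩ := mem_span_pair.1 h1
  obtain ⟨r, s, hrs⟩ := mem_span_pair.1 h2
  obtain ⟨m, n, hmn⟩ := mem_span_pair.1 h3
  rw [← hmn] at hpq hrs ⊢
  have k1 := H.coeffs_eq_zero hx hy hx0 hxy (α := p - 1) (β := p - m) (γ := q - n) (by
    rw [← sub_eq_zero.2 hpq]; module)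
  have k2 := H.coeffs_eq_zero hx hy hx0 hxy (α := r - 1) (β := s - m) (γ := r - n) (by
    rw [← sub_eq_zero.2 hrs]; module)
  obtain rfl : p = 1 := sub_eq_zero.1 k1.1
  obtain rfl : r = 1 := sub_eq_zero.1 k2.1
  rw [← sub_eq_zero.1 k1.2.1, ← sub_eq_zero.1 k2.2.2, one_smul, one_smul]

theorem exists_coeff (a : F) {x : V} (hx : c x = 0) : ∃ s : F, h (a • x) = s • h x := by
  have h1 : h (a • x) ∈ span F {h x} :=
    (H.mem_singleton_iff (by simp [hx]) hx).1 (smul_mem _ _ (mem_span_singleton_self x))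
  obtain ⟨s, hs⟩ := mem_span_singleton.1 h1
  exact ⟨s, hs.symm⟩

variable (hinf : ∀ x y z : V, ∃ w, w ∉ span F {x, y, z})
include hinf

/-- A vector outside the span of `e`, `x`, `y` is projected to the kernel of `c` along `e`. -/
theorem exists_notMem (x y : V) : ∃ z, c z = 0 ∧ z ∉ span F {x, y} := by
  obtain ⟨w, hw⟩ := hinf e x y
  refine ⟨w - c w • e, by simp [H.apply_e], fun hmem => hw ?_⟩
  rw [span_insert, mem_sup]
  exact ⟨c w • e, smul_mem _ _ (mem_span_singleton_self e), _, hmem, by abel⟩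

/-- For possibly dependent `x` and `y`, take `z` outside their span and expand `h (x + y + z)` in
two ways; every split used is between independent vectors or has a zero first term. -/
theorem map_add {x y : V} (hx : c x = 0) (hy : c y = 0) : h (x + y) = h x + h y := by
  obtain ⟨z, hz, hzxy⟩ := H.exists_notMem hinf x y
  have e1 : h (x + y + z) = h (x + y) + h z := by
    refine H.map_add_of_notMem (by simp [hx, hy]) hz fun hm => hzxy ?_
    refine (span_singleton_le_iff_mem _ _).2 ?_ hm
    exact mem_span_pair.2 ⟨1, 1, by module⟩
  have e2 : h (x + (y + z)) = h x + h (y + z) := by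
    refine H.map_add_of_notMem hx (by simp [hz, hy]) fun hm => hzxy ?_
    obtain ⟨a, ha⟩ := mem_span_singleton.1 hm
    exact mem_span_pair.2 ⟨a, -1, by rw [ha]; module⟩
  have e3 : h (y + z) = h y + h z := by
    refine H.map_add_of_notMem hy hz fun hm => hzxy ?_
    exact span_mono (by simp) hm
  rw [add_assoc, e2, e3, ← add_assoc] at e1
  exact (add_right_cancel e1).symm

/-- Additivity forces the scalar attached to `x + y` to agree with those attached to `x` and to `y`.
-/
theorem coeff_unique_of_notMem {a s t : F} {x y : V} (hx : c x = 0) (hy : c y = 0) (hx0 : x ≠ 0)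
    (hxy : y ∉ span F {x}) (hs : h (a • x) = s • h x) (ht : h (a • y) = t • h y) : s = t := by
  have hax : c (a • x) = 0 := by simp [hx]
  have hay : c (a • y) = 0 := by simp [hy]
  obtain ⟨r, hr⟩ := H.exists_coeff a (x := x + y) (by simp [hx, hy])
  rw [smul_add, H.map_add hinf hax hay, H.map_add hinf hx hy, hs, ht] at hr
  have k := H.coeffs_eq_zero hx hy hx0 hxy (α := 0) (β := s - r) (γ := t - r) (by
    rw [← sub_eq_zero.2 hr]; module)
  rw [sub_eq_zero.1 k.2.1, sub_eq_zero.1 k.2.2]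

/-- Dependent `x` and `y` are both compared with a third vector outside their span. -/
theorem coeff_unique {a s t : F} {x y : V} (hx : c x = 0) (hy : c y = 0) (hx0 : x ≠ 0)
    (hy0 : y ≠ 0) (hs : h (a • x) = s • h x) (ht : h (a • y) = t • h y) : s = t := by
  obtain ⟨z, hz, hzxy⟩ := H.exists_notMem hinf x y
  obtain ⟨r, hr⟩ := H.exists_coeff a hz
  rw [H.coeff_unique_of_notMem hinf hx hz hx0 (fun hm => hzxy (span_mono (by simp) hm)) hs hr,
    H.coeff_unique_of_notMem hinf hy hz hy0 (fun hm => hzxy (span_mono (by simp) hm)) ht hr]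

/-- The field homomorphism attached to a normalized lift. -/
theorem exists_ringHom : ∃ σ : F →+* F, ∀ a x, c x = 0 → h (a • x) = σ a • h x := by
  obtain ⟨x₀, hc₀, hx₀⟩ := H.exists_notMem hinf 0 0
  have hx0 : x₀ ≠ 0 := by
    rintro rfl
    exact hx₀ (zero_mem _)
  choose s hs using fun a => H.exists_coeff a hc₀
  have key : ∀ a x, c x = 0 → h (a • x) = s a • h x := by
    intro a x hx
    by_cases hx1 : x = 0
    · simp [hx1, H.apply_zero]
    obtain ⟨t, ht⟩ := H.exists_coeff a hx
    rw [ht, H.coeff_unique hinf hc₀ hx hx0 hx1 (hs a) ht]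
  have inj : Function.Injective fun t : F => t • h x₀ := smul_left_injective F (H.ne_zero hc₀ hx0)
  have hc₁ : ∀ a : F, c (a • x₀) = 0 := fun a => by simp [hc₀]
  refine ⟨{ toFun := s, map_one' := ?_, map_mul' := ?_, map_zero' := ?_, map_add' := ?_ }, key⟩
  · exact inj (by simp [← hs])
  · intro a b
    refine inj ?_
    change s (a * b) • h x₀ = (s a * s b) • h x₀
    rw [← hs, mul_smul, key a _ (hc₁ b), hs b, mul_smul]
  · exact inj (by simp [← hs, H.apply_zero])
  · intro a b
    refine inj ?_
    change s (a + b) • h x₀ = (s a + s b) • h x₀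
    rw [← hs, add_smul, H.map_add hinf (hc₁ a) (hc₁ b), hs, hs, add_smul]

end NormalizedLift

/-- The fundamental theorem of projective geometry. -/
theorem exists_semilinear {T : V → V} (hT : PreservesLines F T) (h0 : T 0 = 0)
    (hsurj : ∀ y, ∃ (v : V) (a : F), y = a • T v) {e : V} {c : V →ₗ[F] F} (hc : c e = 1)
    (hinf : ∀ x y z : V, ∃ w, w ∉ span F {x, y, z}) :
    ∃ (σ : F ≃+* F) (μ : V → V),
      (∀ (a b : F) (u v : V), μ (a • u + b • v) = σ a • μ u + σ b • μ v) ∧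
      Function.Bijective μ ∧ ∀ v, span F {μ v} = span F {T v} := by
  obtain ⟨h, H⟩ := exists_normalizedLift hT h0 hc
  obtain ⟨σ, hσ⟩ := H.exists_ringHom hinf
  have hk : ∀ v, c (v - c v • e) = 0 := fun v => by simp [hc]
  -- The semilinear extension of `h` from the kernel of `c` that sends `e` to `T e`.
  let μ : V → V := fun v => σ (c v) • T e + h (v - c v • e)
  have semi : ∀ (a b : F) (u v : V), μ (a • u + b • v) = σ a • μ u + σ b • μ v := by
    intro a b u v
    have e1 : a • u + b • v - c (a • u + b • v) • e =
        a • (u - c u • e) + b • (v - c v • e) := by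
      simp only [map_add, map_smul, smul_eq_mul]
      module
    simp only [μ, e1]
    rw [H.map_add hinf (by simp [hc]) (by simp [hc]), hσ _ _ (hk u), hσ _ _ (hk v)]
    simp only [map_add, map_smul, smul_eq_mul, map_mul]
    module
  have smul : ∀ (a : F) (v : V), μ (a • v) = σ a • μ v := fun a v => by
    simpa using semi a 0 v 0
  have rep : ∀ v, Rep F T v (μ v) := by
    intro v
    by_cases hv : c v = 0
    · simpa [μ, hv] using H.rep v hv
    -- Off the kernel, `v` is rescaled to the form `e + x` with `c x = 0`, where `rep_add` applies.
    have hcx : c ((c v)⁻¹ • v - e) = 0 := by simp [hc, hv]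
    have e1 : e + ((c v)⁻¹ • v - e) = (c v)⁻¹ • v := by abel
    have e2 : T e + h ((c v)⁻¹ • v - e) = (σ (c v))⁻¹ • μ v := by
      rw [← map_inv₀ σ, ← smul]
      simp [μ, hv]
    have h1 := H.rep_add _ hcx
    rw [e1, e2] at h1
    have h2 : span F {T v} = span F {μ v} := by
      have h3 : span F {T ((c v)⁻¹ • v)} = span F {T v} := by
        refine le_antisymm ?_ ?_ <;> rw [span_singleton_le_iff_mem]
        · have := (hT ((c v)⁻¹ • v) v v).1
            (mem_span_pair.2 ⟨(c v)⁻¹, 0, by simp⟩)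
          simpa using this
        · have := (hT v ((c v)⁻¹ • v) ((c v)⁻¹ • v)).1
            (mem_span_pair.2 ⟨c v, 0, by simp [smul_smul, hv]⟩)
          simpa using this
      rw [← h3, ← h1.span_eq, span_singleton_smul_eq]
      exact (IsUnit.mk0 _ (by simpa using hv)).inv
    obtain ⟨z, hz⟩ := span_singleton_eq_span_singleton.1 h2.symm
    exact ⟨z, z.ne_zero, hz.symm⟩
  have hσs : Function.Surjective σ := by
    intro s
    obtain ⟨x₀, hc₀, hx₀⟩ := H.exists_notMem hinf 0 0
    have hx0 : x₀ ≠ 0 := by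
      rintro rfl
      exact hx₀ (zero_mem _)
    -- This vector is a multiple `m • μ v`. The coefficient of `T e` gives `m * σ (c v) = 1`; the
    -- kernel part of `v` is then some `b • x₀` with `s = m * σ b`, so `s = σ (b / c v)`.
    obtain ⟨v, t, hvt⟩ := hsurj (T e + s • h x₀)
    obtain ⟨r, -, hr⟩ := rep v
    rw [hr, smul_smul] at hvt
    generalize t * r = m at hvt
    have e1 : (1 - m * σ (c v)) • T e + s • h x₀ + (-m) • h (v - c v • e) = 0 := by
      rw [← sub_eq_zero] at hvt
      rw [← hvt]
      simp only [μ]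
      module
    have e2 := H.coeff_base_eq_zero hc₀ (hk v) e1
    rw [e2, zero_smul, zero_add] at e1
    have hm : m ≠ 0 := by
      rintro rfl
      simp at e2
    have hmem : v - c v • e ∈ span F {x₀} := by
      rw [H.mem_singleton_iff (hk v) hc₀, ← smul_mem_iff _ hm]
      refine mem_span_singleton.2 ⟨s, ?_⟩
      rw [← sub_eq_zero, ← e1]
      module
    obtain ⟨b, hb⟩ := mem_span_singleton.1 hmem
    rw [← hb, hσ b _ hc₀, smul_smul, ← add_smul] at e1
    have e3 := (smul_eq_zero.1 e1).resolve_right (H.ne_zero hc₀ hx0)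
    have hcv : σ (c v) ≠ 0 := by
      intro hz
      simp [hz] at e2
    refine ⟨b / c v, ?_⟩
    rw [map_div₀, div_eq_iff hcv]
    linear_combination σ b * e2 - σ (c v) * e3
  refine ⟨RingEquiv.ofBijective σ ⟨σ.injective, hσs⟩, μ, semi, ⟨?_, ?_⟩, fun v => (rep v).span_eq⟩
  · intro u v huv
    have h1 : μ (u - v) = 0 := by
      have := semi 1 (-1) u v
      simp only [map_neg, map_one, one_smul, neg_smul, ← sub_eq_add_neg] at this
      rw [this, huv, sub_self]
    obtain ⟨a, -, ha⟩ := rep (u - v)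
    rw [h1, smul_zero] at ha
    have h2 := (hT (u - v) 0 0).2 (by simp [ha, h0])
    exact sub_eq_zero.1 (by simpa using h2)
  · intro y
    obtain ⟨v, a, rfl⟩ := hsurj y
    obtain ⟨r, -, hr⟩ := rep v
    obtain ⟨b, hb⟩ := hσs (a * r)
    exact ⟨b • v, by rw [smul, hb, hr, smul_smul]⟩

end Projective

end TuringAut

namespace TuringAut

/-! ### Semilinear maps that are computable from the images of five subspaces -/

section Coding

open Submodule

variable {F V : Type*} [Field F] [AddCommGroup V] [Module F V]

/-- The map `f` is the identity on the first span and zero on the second. -/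
theorem disjoint_span_range {w w' : ℕ → V} (f : V →ₗ[F] V) (hw : ∀ n, f (w n) = w n)
    (hw' : ∀ n, f (w' n) = 0) :
    Disjoint (span F (Set.range w)) (span F (Set.range w')) := by
  rw [disjoint_def]
  intro x hx hx'
  have h1 : span F (Set.range w) ≤ LinearMap.eqLocus f LinearMap.id :=
    span_le.2 (by rintro _ ⟨n, rfl⟩; exact hw n)
  have h2 : span F (Set.range w') ≤ LinearMap.ker f :=
    span_le.2 (by rintro _ ⟨n, rfl⟩; exact hw' n)
  have e1 : f x = x := h1 hx
  have e2 : f x = 0 := h2 hx'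
  rw [← e1, e2]

section Basis

variable (b : Module.Basis ℕ F V)

/-- The linear map sending `b (2 * n)` to `w n` and `b (2 * n + 1)` to `w' n`. -/
noncomputable def alternating (w w' : ℕ → V) : V →ₗ[F] V :=
  b.constr F fun n => if n % 2 = 0 then w (n / 2) else w' (n / 2)

theorem alternating_even (w w' : ℕ → V) (n : ℕ) : alternating b w w' (b (2 * n)) = w n := by
  simp [alternating]

theorem alternating_odd (w w' : ℕ → V) (n : ℕ) :
    alternating b w w' (b (2 * n + 1)) = w' n := by
  have h1 : (2 * n + 1) % 2 = 1 := by omega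
  have h2 : (2 * n + 1) / 2 = n := by omega
  simp [alternating, h1, h2]

/-- The span of the basis vectors with even index. -/
def evenSpan : Submodule F V := span F (Set.range fun n => b (2 * n))

/-- The span of the basis vectors with odd index. -/
def oddSpan : Submodule F V := span F (Set.range fun n => b (2 * n + 1))

/-- The graph of `b (2 * n) ↦ a n • b (2 * n + 1)`. -/
def evenGraph (a : ℕ → F) : Submodule F V :=
  span F (Set.range fun n => b (2 * n) + a n • b (2 * n + 1))

/-- The graph of `b (2 * n + 1) ↦ b (2 * n + 2)`. -/
def oddGraph : Submodule F V := span F (Set.range fun n => b (2 * n + 1) + b (2 * n + 2))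

theorem disjoint_evenGraph_oddSpan (a : ℕ → F) : Disjoint (evenGraph b a) (oddSpan b) :=
  disjoint_span_range (alternating b (fun n => b (2 * n) + a n • b (2 * n + 1)) 0)
    (fun n => by simp [alternating_even, alternating_odd])
    (fun n => by simp [alternating_odd])

theorem disjoint_evenSpan_oddSpan : Disjoint (evenSpan b) (oddSpan b) :=
  disjoint_span_range (alternating b (fun n => b (2 * n)) 0)
    (fun n => by simp [alternating_even]) (fun n => by simp [alternating_odd])

theorem disjoint_oddGraph_evenSpan : Disjoint (oddGraph b) (evenSpan b) :=
  disjoint_span_range (alternating b 0 fun n => b (2 * n + 1) + b (2 * n + 2))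
    (fun n => by
      have h : 2 * n + 2 = 2 * (n + 1) := by ring
      rw [map_add, alternating_odd, h, alternating_even, Pi.zero_apply, add_zero])
    (fun n => by simp [alternating_even])

theorem even_mem (n : ℕ) : b (2 * n) ∈ evenSpan b := subset_span ⟨n, rfl⟩

theorem odd_mem (n : ℕ) : b (2 * n + 1) ∈ oddSpan b := subset_span ⟨n, rfl⟩

theorem evenGraph_mem (a : ℕ → F) (n : ℕ) : b (2 * n) + a n • b (2 * n + 1) ∈ evenGraph b a :=
  subset_span ⟨n, rfl⟩

theorem oddGraph_mem (n : ℕ) : b (2 * n + 1) + b (2 * n + 2) ∈ oddGraph b :=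
  subset_span ⟨n, rfl⟩

theorem evenSpan_sup_oddSpan : evenSpan b ⊔ oddSpan b = ⊤ := by
  rw [eq_top_iff, ← b.span_eq, span_le]
  rintro _ ⟨n, rfl⟩
  rcases Nat.even_or_odd' n with ⟨k, rfl | rfl⟩
  · exact mem_sup_left (even_mem b k)
  · exact mem_sup_right (odd_mem b k)

/-- Says that the map with this graph is defined on the whole even span, as
`exists_computableIn_graph` requires; `oddSpan_le` plays the same role for the other graph. -/
theorem evenSpan_le (a : ℕ → F) : evenSpan b ≤ oddSpan b ⊔ evenGraph b a := by
  refine span_le.2 ?_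
  rintro _ ⟨n, rfl⟩
  exact mem_sup.2 ⟨-(a n • b (2 * n + 1)), neg_mem (smul_mem _ _ (odd_mem b n)), _,
    evenGraph_mem b a n, by abel⟩

theorem oddSpan_le : oddSpan b ≤ evenSpan b ⊔ oddGraph b := by
  refine span_le.2 ?_
  rintro _ ⟨n, rfl⟩
  exact mem_sup.2 ⟨-b (2 * (n + 1)), neg_mem (even_mem b (n + 1)), _,
    oddGraph_mem b n, by rw [mul_add]; abel⟩

end Basis

variable [Primcodable V]

theorem DEnumerable.exists_range {D : OracleSet} {W : Submodule F V}
    (h : DEnumerable (deg D) (W : Set V)) :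
    ∃ f : ℕ → V, ComputableIn {chi D} f ∧ Set.range f = W := by
  obtain h | ⟨f, hf, h⟩ := h
  · exact absurd h W.nonempty.ne_empty
  · exact ⟨f, hf.exists_rep le_rfl, h⟩

variable [Primcodable F]

/-- If `R` is the graph of a linear map from `P` to a complement `Q` of `P`, then this map is
computable from enumerations of `P`, `Q` and `R`. -/
theorem exists_computableIn_graph (hV : IsComputableVectorSpace F V) {D : OracleSet}
    {P Q R : Submodule F V} (hP : DEnumerable (deg D) (P : Set V))
    (hQ : DEnumerable (deg D) (Q : Set V)) (hR : DEnumerable (deg D) (R : Set V))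
    (hPQ : P ⊔ Q = ⊤) (hPQ' : Disjoint P Q) (hPR : P ≤ Q ⊔ R) (hRQ : Disjoint R Q) :
    ∃ f : V → V, ComputableIn {chi D} f ∧ ∀ y ∈ P, ∀ w ∈ Q, y + w ∈ R → f y = w := by
  classical
  obtain ⟨A, hA, rA⟩ := hP.exists_range
  obtain ⟨B, hB, rB⟩ := hQ.exists_range
  obtain ⟨C, hC, rC⟩ := hR.exists_range
  have mA : ∀ n, A n ∈ P := fun n => rA.subset ⟨n, rfl⟩
  have mB : ∀ n, B n ∈ Q := fun n => rB.subset ⟨n, rfl⟩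
  have mC : ∀ n, C n ∈ R := fun n => rC.subset ⟨n, rfl⟩
  have hadd : ComputableIn {chi D} (fun p : V × V => p.1 + p.2) := Computable.computableIn hV.add
  let K := ℕ × ℕ × ℕ × ℕ
  have k1 : ComputableIn {chi D} (fun p : V × ℕ => (enum (0, 0, 0, 0) p.2 : K).1) :=
    computableIn_comp ComputableIn.fst (computableIn_comp (computableIn_enum _) ComputableIn.snd)
  have hp2 : ComputableIn {chi D} (fun p : V × ℕ => (enum (0, 0, 0, 0) p.2 : K).2) :=
    computableIn_comp ComputableIn.snd (computableIn_comp (computableIn_enum _) ComputableIn.snd)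
  have k2 := computableIn_comp ComputableIn.fst hp2
  have hp3 := computableIn_comp ComputableIn.snd hp2
  have k3 := computableIn_comp ComputableIn.fst hp3
  have k4 := computableIn_comp ComputableIn.snd hp3
  have s1 := computableIn_comp hadd (computableIn_pair (computableIn_comp hA k1)
    (computableIn_comp hB k2))
  have s2 := computableIn_comp hadd (computableIn_pair (computableIn_comp hA k1)
    (computableIn_comp hB k3))
  have t := computableIn_decide_eq (computableIn_pair s1 s2)
    (computableIn_pair ComputableIn.fst (computableIn_comp hC k4))
  -- Search for `y = p + q` with `p ∈ P`, `q ∈ Q`, and for `w ∈ Q` with `p + w ∈ R`. Allowing the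
  -- component `q` makes the search succeed for every `y`, not only for `y ∈ P`.
  obtain ⟨g, hg, hg'⟩ := exists_computableIn_find_prop
    (P := fun (y : V) n => (A (enum (0, 0, 0, 0) n : K).1 + B (enum (0, 0, 0, 0) n : K).2.1,
      A (enum (0, 0, 0, 0) n : K).1 + B (enum (0, 0, 0, 0) n : K).2.2.1) =
      (y, C (enum (0, 0, 0, 0) n : K).2.2.2)) t (by
    intro y
    have hy : y ∈ P ⊔ Q := hPQ ▸ mem_top
    obtain ⟨p, hp, q, hq, rfl⟩ := mem_sup.1 hy
    obtain ⟨u, hu, r, hr, rfl⟩ := mem_sup.1 (hPR hp)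
    obtain ⟨i, hi⟩ := rA.symm.subset hp
    obtain ⟨j, rfl⟩ := rB.symm.subset hq
    obtain ⟨k, hk⟩ := rB.symm.subset (neg_mem hu)
    obtain ⟨l, rfl⟩ := rC.symm.subset hr
    refine ⟨Encodable.encode ((i, j, k, l) : K), ?_⟩
    simp only [enum_encode, hi, hk]
    simp)
  refine ⟨fun y => B (enum (0, 0, 0, 0) (g y) : K).2.2.1, computableIn_comp hB
    (computableIn_comp ComputableIn.fst (computableIn_comp ComputableIn.snd
      (computableIn_comp ComputableIn.snd (computableIn_comp (computableIn_enum _) hg)))), ?_⟩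
  intro y hy w hw hyw
  obtain ⟨e1, e2⟩ := Prod.mk.inj (hg' y)
  change B (enum (0, 0, 0, 0) (g y) : K).2.2.1 = w
  generalize (enum (0, 0, 0, 0) (g y) : K) = z at e1 e2 ⊢
  -- For `y ∈ P` the component found in `P` is `y` itself, as `P` and `Q` are disjoint.
  have e3 : A z.1 = y := by
    refine sub_eq_zero.1 (disjoint_def.1 hPQ' _ (sub_mem (mA _) hy) ?_)
    rw [← e1]
    simpa using mB _
  rw [e3] at e2
  -- Two values over the same `y` differ by an element of both `R` and `Q`.
  refine sub_eq_zero.1 (disjoint_def.1 hRQ _ ?_ (sub_mem (mB _) hw))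
  have := sub_mem (mC z.2.2.2) hyw
  rwa [← e2, add_sub_add_left_eq_sub] at this

variable {b : Module.Basis ℕ F V}

/-- If a lattice automorphism is induced by `⟨μ, σ⟩` and maps five specific subspaces to
`deg D`-enumerable subspaces, then `μ` and `σ` are computable in `D`. -/
theorem computableIn_of_images (hV : IsComputableVectorSpace F V) (hb : Computable fun n => b n)
    {D : OracleSet} {σ : F ≃+* F} {μ : V → V}
    (hμ : ∀ (a b : F) (u v : V), μ (a • u + b • v) = σ a • μ u + σ b • μ v)
    (Φ : Submodule F V ≃o Submodule F V) (hΦ : ∀ W v, μ v ∈ Φ W ↔ v ∈ W)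
    (h1 : DEnumerable (deg D) (Φ (evenSpan b) : Set V))
    (h2 : DEnumerable (deg D) (Φ (oddSpan b) : Set V))
    (h3 : DEnumerable (deg D) (Φ (evenGraph b fun _ => 1) : Set V))
    (h4 : DEnumerable (deg D) (Φ (oddGraph b) : Set V))
    (h5 : DEnumerable (deg D) (Φ (evenGraph b (enum 0)) : Set V)) :
    ComputableIn {chi D} μ ∧ ComputableIn {chi D} fun a => σ a := by
  classical
  have add : ∀ u v, μ (u + v) = μ u + μ v := fun u v => by simpa using hμ 1 1 u v
  have smul : ∀ (a : F) u, μ (a • u) = σ a • μ u := fun a u => by simpa using hμ a 0 u 0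
  have hadd : ComputableIn {chi D} (fun p : V × V => p.1 + p.2) := Computable.computableIn hV.add
  have hsmul : ComputableIn {chi D} (fun p : F × V => p.1 • p.2) :=
    Computable.computableIn hV.smul
  have dis : ∀ {P Q : Submodule F V}, Disjoint P Q → Disjoint (Φ P) (Φ Q) := fun h => h.map_orderIso Φ
  have le : ∀ {P Q R : Submodule F V}, P ≤ Q ⊔ R → Φ P ≤ Φ Q ⊔ Φ R := fun h => by
    rwa [← Φ.map_sup, Φ.le_iff_le]
  have top : Φ (evenSpan b) ⊔ Φ (oddSpan b) = ⊤ := by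
    rw [← Φ.map_sup, evenSpan_sup_oddSpan, Φ.map_top]
  obtain ⟨E, hE, hE'⟩ := exists_computableIn_graph hV h1 h2 h3 top
    (dis (disjoint_evenSpan_oddSpan b)) (le (evenSpan_le b _))
    (dis (disjoint_evenGraph_oddSpan b _))
  obtain ⟨G, hG, hG'⟩ := exists_computableIn_graph hV h2 h1 h4 (by rw [sup_comm, top])
    (dis (disjoint_evenSpan_oddSpan b).symm) (le (oddSpan_le b))
    (dis (disjoint_oddGraph_evenSpan b))
  have eE : ∀ n, E (μ (b (2 * n))) = μ (b (2 * n + 1)) := fun n =>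
    hE' _ ((hΦ _ _).2 (even_mem b n)) _ ((hΦ _ _).2 (odd_mem b n)) (by
      rw [← add, hΦ]
      simpa using evenGraph_mem b (fun _ => 1) n)
  have eG : ∀ n, G (μ (b (2 * n + 1))) = μ (b (2 * (n + 1))) := fun n =>
    hG' _ ((hΦ _ _).2 (odd_mem b n)) _ ((hΦ _ _).2 (even_mem b (n + 1))) (by
      rw [← add, hΦ]
      exact oddGraph_mem b n)
  -- The images of the basis vectors.
  have heven : ComputableIn {chi D} fun n => μ (b (2 * n)) := by
    -- One round of `E` and then `G` moves from `μ (b (2n))` to `μ (b (2n+2))`; only the vector `μ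
    -- (b 0)` has to be supplied.
    have hs : ComputableIn {chi D} fun p : V × ℕ => G (E p.1) :=
      computableIn_comp hG (computableIn_comp hE ComputableIn.fst)
    have := computableIn_comp (computableIn_rec hs)
      (computableIn_pair (ComputableIn.const (μ (b 0))) (ComputableIn.id : ComputableIn _ (@id ℕ)))
    refine RecursiveIn.of_eq this fun n => congrArg Part.some ?_
    change (Nat.rec (μ (b 0)) (fun _ x => G (E x)) n : V) = _
    induction n with
    | zero => rfl
    | succ n ih => simp only [ih, eE, eG]
  have hodd : ComputableIn {chi D} fun n => μ (b (2 * n + 1)) := by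
    refine RecursiveIn.of_eq (computableIn_comp hE heven) fun n => ?_
    exact congrArg Part.some (eE n)
  have hbasis : ComputableIn {chi D} fun n => μ (b n) := by
    have hdiv : ComputableIn {chi D} (fun n : ℕ => n / 2) :=
      (Primrec.nat_div.comp Primrec.id (Primrec.const 2)).computableIn
    have hsel : ComputableIn {chi D}
        (fun p : ℕ × V × V => if p.1 % 2 = 0 then p.2.1 else p.2.2) :=
      (Primrec.ite (Primrec.eq.comp (Primrec.nat_mod.comp Primrec.fst (Primrec.const 2))
        (Primrec.const 0)) (Primrec.fst.comp Primrec.snd)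
        (Primrec.snd.comp Primrec.snd)).computableIn
    have key := computableIn_comp hsel (computableIn_pair ComputableIn.id
      (computableIn_pair (computableIn_comp heven hdiv) (computableIn_comp hodd hdiv)))
    refine RecursiveIn.of_eq key fun n => congrArg Part.some ?_
    rcases Nat.even_or_odd' n with ⟨k, rfl | rfl⟩
    · simp
    · have e1 : (2 * k + 1) / 2 = k := by omega
      have e2 : (2 * k + 1) % 2 = 1 := by omega
      simp [e1, e2]
  -- The field automorphism.
  have hσ : ComputableIn {chi D} fun n => σ (enum 0 n) := by
    obtain ⟨C, hC, rC⟩ := h5.exists_range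
    let K := F × ℕ
    have k1 : ComputableIn {chi D} (fun p : ℕ × ℕ => (enum (0, 0) p.2 : K).1) :=
      computableIn_comp ComputableIn.fst
        (computableIn_comp (computableIn_enum _) ComputableIn.snd)
    have k2 : ComputableIn {chi D} (fun p : ℕ × ℕ => (enum (0, 0) p.2 : K).2) :=
      computableIn_comp ComputableIn.snd
        (computableIn_comp (computableIn_enum _) ComputableIn.snd)
    have s1 := computableIn_comp hsmul
      (computableIn_pair k1 (computableIn_comp hodd ComputableIn.fst))
    have s2 := computableIn_comp hadd
      (computableIn_pair (computableIn_comp heven ComputableIn.fst) s1)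
    have t := computableIn_decide_eq s2 (computableIn_comp hC k2)
    -- Search for a scalar that puts the combination into the image of the fifth subspace. The
    -- scalar `σ (enum 0 n)` qualifies, and disjointness from the odd span makes it the only one.
    obtain ⟨g, hg, hg'⟩ := exists_computableIn_find_prop
      (P := fun n m => μ (b (2 * n)) + (enum (0, 0) m : K).1 • μ (b (2 * n + 1)) =
        C (enum (0, 0) m : K).2) t (by
      intro n
      have hm : μ (b (2 * n)) + σ (enum 0 n) • μ (b (2 * n + 1)) ∈ Φ (evenGraph b (enum 0)) := by
        rw [← smul, ← add, hΦ]
        exact evenGraph_mem b _ n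
      obtain ⟨k, hk⟩ := rC.symm.subset hm
      exact ⟨Encodable.encode ((σ (enum 0 n), k) : K), by rw [enum_encode, hk]⟩)
    refine RecursiveIn.of_eq (computableIn_comp ComputableIn.fst
      (computableIn_comp (computableIn_enum ((0, 0) : K)) hg)) fun n => congrArg Part.some ?_
    obtain ⟨a, ha⟩ := σ.surjective (enum (0, 0) (g n) : K).1
    have e1 : μ (b (2 * n)) + (enum (0, 0) (g n) : K).1 • μ (b (2 * n + 1)) ∈
        Φ (evenGraph b (enum 0)) := by
      rw [hg' n]
      exact rC.subset ⟨_, rfl⟩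
    change (enum (0, 0) (g n) : K).1 = _
    rw [← ha] at e1 ⊢
    rw [← smul, ← add, hΦ] at e1
    have e2 := sub_mem e1 (evenGraph_mem b (enum 0) n)
    rw [add_sub_add_left_eq_sub, ← sub_smul] at e2
    have e3 := disjoint_def.1 (disjoint_evenGraph_oddSpan b _) _ e2
      (smul_mem _ _ (odd_mem b n))
    rw [sub_eq_zero.1 ((smul_eq_zero.1 e3).resolve_right (b.ne_zero _))]
  refine ⟨?_, ?_⟩
  · have hc : ComputableIn {chi D} fun p : ℕ × ℕ => comb (enum (0 : F)) b p.1 p.2 :=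
      computableIn_comb hV (computableIn_enum _) hb.computableIn
    -- A code of the coordinates of `v` is found by search; the same code, read with coefficients `σ
    -- (enum 0 k)` and vectors `μ (b k)`, yields `μ v`.
    obtain ⟨g, hg, hg'⟩ := exists_computableIn_rightInverse hc fun v => by
      obtain ⟨n, c, h⟩ := exists_comb_eq_of_mem_span (enum_surjective (0 : F))
        (w := b) (v := v) (b.span_eq ▸ mem_top)
      exact ⟨(n, c), h⟩
    refine RecursiveIn.of_eq (computableIn_comp (computableIn_comb hV hσ hbasis) hg)
      fun v => congrArg Part.some ?_
    conv_rhs => rw [← hg' v]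
    let μ' : V →+ V := ⟨⟨μ, by simpa using smul 0 0⟩, add⟩
    change _ = μ' _
    simp only [comb, map_sum]
    exact Finset.sum_congr rfl fun k _ => (smul _ _).symm
  · refine RecursiveIn.of_eq (computableIn_comp hσ computableIn_encode) fun a => ?_
    exact congrArg Part.some (congrArg σ (enum_encode 0 a))

end Coding

end TuringAut

namespace TuringAut

/-! ### Automorphisms of lattices of subspaces -/

section Automorphisms

open Submodule

variable {F V : Type*} [Field F] [AddCommGroup V] [Module F V]

theorem exists_notMem_span_triple (b : Module.Basis ℕ F V) (x y z : V) :
    ∃ w, w ∉ span F {x, y, z} := by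
  by_contra! h
  have : Module.Finite F V :=
    Module.Finite.of_fg_top ⟨({x, y, z} : Set V).toFinite.toFinset, by
      rw [Set.Finite.coe_toFinset, eq_top_iff]
      exact fun w _ => h w⟩
  exact not_finite_iff_infinite.2 (inferInstance : Infinite ℕ) (Module.Finite.finite_basis b)

/-- The automorphism of the lattice of subspaces that is induced by a semilinear bijection. -/
def orderIsoOfSemilinear (σ : F ≃+* F) (μ : V → V)
    (hμ : ∀ (a b : F) (u v : V), μ (a • u + b • v) = σ a • μ u + σ b • μ v)
    (hbij : Function.Bijective μ) : Submodule F V ≃o Submodule F V :=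
  have add : ∀ u v, μ (u + v) = μ u + μ v := fun u v => by simpa using hμ 1 1 u v
  have smul : ∀ (a : F) u, μ (a • u) = σ a • μ u := fun a u => by simpa using hμ a 0 u 0
  have zero : μ 0 = 0 := by simpa using smul 0 0
  { toFun := fun W =>
      { carrier := μ '' W
        add_mem' := by
          rintro _ _ ⟨u, hu, rfl⟩ ⟨v, hv, rfl⟩
          exact ⟨u + v, add_mem hu hv, add u v⟩
        zero_mem' := ⟨0, zero_mem W, zero⟩
        smul_mem' := by
          rintro a _ ⟨u, hu, rfl⟩
          exact ⟨σ.symm a • u, smul_mem W _ hu, by rw [smul, σ.apply_symm_apply]⟩ }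
    invFun := fun W =>
      { carrier := μ ⁻¹' W
        add_mem' := fun {u v} hu hv => by
          rw [Set.mem_preimage, add]
          exact add_mem hu hv
        zero_mem' := by
          rw [Set.mem_preimage, zero]
          exact zero_mem W
        smul_mem' := fun a u hu => by
          rw [Set.mem_preimage, smul]
          exact smul_mem W _ hu }
    left_inv := fun W => SetLike.coe_injective (Set.preimage_image_eq _ hbij.1)
    right_inv := fun W => SetLike.coe_injective (Set.image_preimage_eq _ hbij.2)
    map_rel_iff' := fun {_ _} => Set.image_subset_image_iff hbij.1 }

/-- Automorphisms of the lattice of subspaces that agree on all lines are equal. -/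
theorem orderIso_ext {Φ Ψ : Submodule F V ≃o Submodule F V}
    (h : ∀ v, Φ (span F {v}) = Ψ (span F {v})) : Φ = Ψ := by
  refine DFunLike.ext _ _ fun W => ?_
  -- Order isomorphisms preserve arbitrary suprema, so the values on lines decide everything.
  have hW : W = ⨆ v : W, span F {(v : V)} := by
    refine le_antisymm (fun v hv => ?_) (iSup_le fun v => ?_)
    · exact mem_iSup_of_mem (⟨v, hv⟩ : W) (mem_span_singleton_self v)
    · exact (span_singleton_le_iff_mem _ _).2 v.2
  rw [hW, OrderIso.map_iSup, OrderIso.map_iSup]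
  simp only [h]

/-! ### Sublattices containing all lines -/

section Sublattice

variable {S : Sublattice (Submodule F V)}

/-- Lines are atoms: for a nonzero `u` in the image of a line, the preimage of `span F {u}` is a
nonzero subspace of that line, hence all of it. The clause on `v = 0` makes the chosen map on
vectors send 0 to 0. -/
theorem exists_span_singleton_eq (hS : ∀ v, span F {v} ∈ S) (φ : S ≃o S) (v : V) :
    ∃ u, span F {u} = (φ ⟨span F {v}, hS v⟩ : Submodule F V) ∧ (v = 0 → u = 0) := by
  have bot : (φ ⟨span F {0}, hS 0⟩ : Submodule F V) = ⊥ := by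
    have h1 : φ ⟨span F {0}, hS 0⟩ ≤ ⟨span F {0}, hS 0⟩ := by
      rw [← φ.le_symm_apply]
      change span F {0} ≤ _
      simp
    have h2 : (φ ⟨span F {0}, hS 0⟩ : Submodule F V) ≤ span F {0} := h1
    simpa using h2
  by_cases hv : v = 0
  · subst hv
    exact ⟨0, by rw [bot]; simp, fun _ => rfl⟩
  have hne : (φ ⟨span F {v}, hS v⟩ : Submodule F V) ≠ ⊥ := by
    intro h
    rw [← bot] at h
    have h' := congrArg Subtype.val (φ.injective (Subtype.ext h))
    simp [hv] at h'
  obtain ⟨u, hu, hu0⟩ := exists_mem_ne_zero_of_ne_bot hne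
  refine ⟨u, ?_, fun h => absurd h hv⟩
  have h1 : (⟨span F {u}, hS u⟩ : S) ≤ φ ⟨span F {v}, hS v⟩ := by
    change span F {u} ≤ _
    exact (span_singleton_le_iff_mem _ _).2 hu
  have h2 : (φ.symm ⟨span F {u}, hS u⟩ : Submodule F V) ≤ span F {v} := φ.symm_apply_le.2 h1
  rcases (nonzero_span_atom v hv).le_iff.1 h2 with h3 | h3
  · have h4 : φ.symm ⟨span F {u}, hS u⟩ ≤ ⟨span F {0}, hS 0⟩ := by
      change (φ.symm ⟨span F {u}, hS u⟩ : Submodule F V) ≤ _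
      simp [h3]
    have h5 : span F {u} ≤ (φ ⟨span F {0}, hS 0⟩ : Submodule F V) := φ.symm_apply_le.1 h4
    rw [bot] at h5
    simp [hu0] at h5
  · have h4 : φ.symm ⟨span F {u}, hS u⟩ = ⟨span F {v}, hS v⟩ := Subtype.ext h3
    rw [← h4, φ.apply_symm_apply]

/-- An automorphism of a sublattice that contains all lines is induced by a semilinear
bijection. -/
theorem exists_semilinear_of_orderIso (b : Module.Basis ℕ F V) (hS : ∀ v, span F {v} ∈ S)
    (φ : S ≃o S) :
    ∃ (σ : F ≃+* F) (μ : V → V)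
      (hμ : ∀ (a b : F) (u v : V), μ (a • u + b • v) = σ a • μ u + σ b • μ v)
      (hbij : Function.Bijective μ), Extends (orderIsoOfSemilinear σ μ hμ hbij) φ := by
  choose T hT hT0 using exists_span_singleton_eq hS φ
  have lines : PreservesLines F T := by
    intro u v w
    rw [span_insert, span_insert, ← span_singleton_le_iff_mem, ← span_singleton_le_iff_mem, hT,
      hT, hT]
    -- Joins in the sublattice are joins of subspaces, so incidence of lines is visible to `φ`.
    have h : (⟨span F {u}, hS u⟩ : S) ≤ ⟨span F {v}, hS v⟩ ⊔ ⟨span F {w}, hS w⟩ ↔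
        φ ⟨span F {u}, hS u⟩ ≤ φ ⟨span F {v}, hS v⟩ ⊔ φ ⟨span F {w}, hS w⟩ := by
      rw [← φ.map_sup, φ.le_iff_le]
    exact h
  have hsurj : ∀ y, ∃ (v : V) (a : F), y = a • T v := by
    intro y
    obtain ⟨v, hv, -⟩ := exists_span_singleton_eq hS φ.symm y
    have h1 : (⟨span F {v}, hS v⟩ : S) = φ.symm ⟨span F {y}, hS y⟩ := Subtype.ext hv
    have h2 : y ∈ span F {T v} := by
      rw [hT, h1, φ.apply_symm_apply]
      exact mem_span_singleton_self y
    obtain ⟨a, ha⟩ := mem_span_singleton.1 h2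
    exact ⟨v, a, ha.symm⟩
  obtain ⟨σ, μ, hμ, hbij, hspan⟩ := exists_semilinear lines (hT0 0 rfl) hsurj
    (e := b 0) (c := b.coord 0) (by simp) (exists_notMem_span_triple b)
  refine ⟨σ, μ, hμ, hbij, fun W => SetLike.ext fun y => ?_⟩
  have key : ∀ v, μ v ∈ (φ W : Submodule F V) ↔ v ∈ (W : Submodule F V) := by
    intro v
    rw [← span_singleton_le_iff_mem, hspan, hT, ← span_singleton_le_iff_mem]
    exact φ.le_iff_le (x := ⟨span F {v}, hS v⟩) (y := W)
  obtain ⟨v, rfl⟩ := hbij.2 y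
  rw [key]
  exact hbij.1.mem_set_image

theorem Extends.unique (hS : ∀ v, span F {v} ∈ S) {φ : S ≃o S}
    {Φ Ψ : Submodule F V ≃o Submodule F V} (hΦ : Extends Φ φ) (hΨ : Extends Ψ φ) : Φ = Ψ :=
  orderIso_ext fun v => (hΦ ⟨_, hS v⟩).trans (hΨ ⟨_, hS v⟩).symm

theorem mem_autExt_of_forall_mem_iff {Φ : Submodule F V ≃o Submodule F V}
    (h : ∀ W, Φ W ∈ S ↔ W ∈ S) : Φ ∈ autExt S :=
  ⟨{ toFun := fun W => ⟨Φ W, (h _).2 W.2⟩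
     invFun := fun W => ⟨Φ.symm W, (h _).1 (by rw [Φ.apply_symm_apply]; exact W.2)⟩
     left_inv := fun W => Subtype.ext (Φ.symm_apply_apply _)
     right_inv := fun W => Subtype.ext (Φ.apply_symm_apply _)
     map_rel_iff' := fun {_ _} => Φ.le_iff_le }, fun _ => rfl⟩

end Sublattice

variable [Primcodable F] [Primcodable V]

/-- The lattice automorphism `W ↦ μ '' W`. -/
def GSL.orderIso {d : Degree} (g : GSL F V d) : Submodule F V ≃o Submodule F V :=
  orderIsoOfSemilinear g.σ g.μ g.semilinear g.bijective

theorem GSL.coe_orderIso {d : Degree} (g : GSL F V d) (W : Submodule F V) :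
    (g.orderIso W : Set V) = g.μ '' W := rfl

theorem DEnumerable.image {α β : Type*} [Primcodable α] [Primcodable β] {d : Degree} {S : Set α}
    (hS : DEnumerable d S) {f : α → β} (hf : DComputable d f) : DEnumerable d (f '' S) := by
  obtain ⟨D, rfl⟩ : ∃ D, deg D = d := Quotient.exists_rep d
  obtain rfl | ⟨g, hg, rfl⟩ := hS
  · exact Or.inl (Set.image_empty f)
  · exact Or.inr ⟨fun n => f (g n),
      ⟨D, rfl, computableIn_comp (hf.exists_rep le_rfl) (hg.exists_rep le_rfl)⟩,
      Set.range_comp f g⟩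

/-- The inverse of a computable bijection is computable by search, so enumerations can be carried in
both directions. -/
theorem GSL.dEnumerable_orderIso_iff {d e : Degree} (g : GSL F V e) (he : e ≤ d)
    (W : Submodule F V) :
    DEnumerable d (g.orderIso W : Set V) ↔ DEnumerable d (W : Set V) := by
  rw [g.coe_orderIso]
  have hμ := g.computable_μ.mono he
  refine ⟨fun h => ?_, fun h => h.image hμ⟩
  obtain ⟨D, rfl, hD⟩ := hμ
  obtain ⟨f, hf, hinv⟩ := exists_computableIn_rightInverse hD g.bijective.2
  have hleft : Function.LeftInverse f g.μ := hinv.leftInverse_of_injective g.bijective.1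
  have := h.image ⟨D, rfl, hf⟩
  rwa [← Set.image_comp, hleft.comp_eq_id, Set.image_id] at this

/-- The ideal of the degrees below `d`. -/
def TuringIdeal.principal (d : Degree) : TuringIdeal where
  carrier := {e | e ≤ d}
  nonempty := ⟨d, le_refl d⟩
  lower := fun _ ha _ hb => le_trans hb ha
  sup_mem := fun _ ha _ hb => sup_le (α := Degree) ha hb

theorem TuringIdeal.mem_principal {d e : Degree} : e ∈ TuringIdeal.principal d ↔ e ≤ d := Iff.rfl

/-- The ideal of all degrees. -/
def TuringIdeal.all : TuringIdeal where
  carrier := Set.univ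
  nonempty := ⟨deg ⟨∅⟩, trivial⟩
  lower := fun _ _ _ _ => trivial
  sup_mem := fun _ _ _ _ => trivial

/-! ### Automorphisms of the lattices attached to ideals and degrees -/

section Main

variable (hV : IsComputableVectorSpace F V)

/-- Reduces statements about one degree to statements about an ideal. -/
theorem latticeOfIdeal_principal (d : Degree) :
    latticeOfIdeal hV (TuringIdeal.principal d) = latticeOfDegree hV d := by
  refine SetLike.ext fun W => ⟨?_, fun h => ?_⟩
  · rintro ⟨e, he, h⟩
    exact DEnumerable.mono h (TuringIdeal.mem_principal.1 he)
  · exact ⟨d, TuringIdeal.mem_principal.2 le_rfl, h⟩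

/-- A subspace of the countable space `V` is the range of a sequence, and that sequence is
computable in some oracle. -/
theorem mem_latticeOfIdeal_all (W : Submodule F V) : W ∈ latticeOfIdeal hV TuringIdeal.all := by
  obtain ⟨f, hf⟩ := (Set.to_countable (W : Set V)).exists_eq_range W.nonempty
  obtain ⟨D, hD⟩ := exists_computableIn f
  exact ⟨deg D, trivial, Or.inr ⟨f, ⟨D, rfl, hD⟩, hf.symm⟩⟩

theorem span_singleton_mem_latticeOfDegree (d : Degree) (v : V) :
    span F {v} ∈ latticeOfDegree hV d :=
  DEnumerable.span_singleton hV d v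

theorem mem_latticeOfIdeal_of_forall (I : TuringIdeal) {W : Submodule F V}
    (h : ∀ d, DEnumerable d (W : Set V)) : W ∈ latticeOfIdeal hV I := by
  obtain ⟨d, hd⟩ := I.nonempty
  exact ⟨d, hd, h d⟩

theorem span_singleton_mem_latticeOfIdeal (I : TuringIdeal) (v : V) :
    span F {v} ∈ latticeOfIdeal hV I :=
  mem_latticeOfIdeal_of_forall hV I fun d => DEnumerable.span_singleton hV d v

theorem dEnumerable_span_range (hV : IsComputableVectorSpace F V) {w : ℕ → V} (hw : Computable w) (d : Degree) :
    DEnumerable d (span F (Set.range w) : Set V) := by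
  obtain ⟨D, rfl⟩ : ∃ D, deg D = d := Quotient.exists_rep d
  exact DEnumerable.span_range hV ⟨D, rfl, hw.computableIn⟩

/-- Every automorphism of `latticeOfIdeal hV I` is induced by a semilinear bijection that is
computable in an element of `I`. -/
theorem exists_gsl_of_ideal (I : TuringIdeal) (φ : latticeOfIdeal hV I ≃o latticeOfIdeal hV I) :
    ∃ d ∈ I, ∃ g : GSL F V d, Extends g.orderIso φ := by
  obtain ⟨b, hb⟩ := hV.basis
  obtain ⟨σ, μ, hμ, hbij, hext⟩ :=
    exists_semilinear_of_orderIso b (span_singleton_mem_latticeOfIdeal hV I) φ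
  -- The span of a computable sequence is enumerable in every degree, so it lies in the domain of
  -- `φ`, and its image is enumerable in some degree of `I`.
  have images : ∀ w : ℕ → V, Computable w → ∃ d ∈ I,
      DEnumerable d (orderIsoOfSemilinear σ μ hμ hbij (span F (Set.range w)) : Set V) := by
    intro w hw
    have h := (φ ⟨_, mem_latticeOfIdeal_of_forall hV I (dEnumerable_span_range hV hw)⟩).2
    rwa [← hext] at h
  have hdouble : Computable fun n : ℕ => 2 * n :=
    (Primrec.nat_mul.comp (Primrec.const 2) Primrec.id).to_comp
  have hbe : Computable fun n => b (2 * n) := hb.comp hdouble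
  have hbo : Computable fun n => b (2 * n + 1) := hb.comp (Computable.succ.comp hdouble)
  have hbe' : Computable fun n => b (2 * n + 2) :=
    hb.comp (Computable.succ.comp (Computable.succ.comp hdouble))
  have henum : Computable (enum (0 : F)) :=
    (Primrec.option_getD.comp Primrec.decode (Primrec.const 0)).to_comp
  obtain ⟨d₁, m₁, h₁⟩ := images _ hbe
  obtain ⟨d₂, m₂, h₂⟩ := images _ hbo
  obtain ⟨d₃, m₃, h₃⟩ := images (fun n => b (2 * n) + (1 : F) • b (2 * n + 1))
    (hV.add.comp hbe (hV.smul.comp (Computable.const 1) hbo))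
  obtain ⟨d₄, m₄, h₄⟩ := images _ (hV.add.comp hbo hbe')
  obtain ⟨d₅, m₅, h₅⟩ := images _ (hV.add.comp hbe (hV.smul.comp henum hbo))
  -- Finitely many subspaces suffice, which is why closure under binary joins is enough.
  have hd : d₁ ⊔ d₂ ⊔ d₃ ⊔ d₄ ⊔ d₅ ∈ I := I.sup_mem _ (I.sup_mem _ (I.sup_mem _
    (I.sup_mem _ m₁ _ m₂) _ m₃) _ m₄) _ m₅
  obtain ⟨D, hD⟩ : ∃ D, deg D = d₁ ⊔ d₂ ⊔ d₃ ⊔ d₄ ⊔ d₅ := Quotient.exists_rep _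
  obtain ⟨cμ, cσ⟩ := computableIn_of_images hV hb (D := D) hμ
    (orderIsoOfSemilinear σ μ hμ hbij) (fun _ _ => hbij.1.mem_set_image)
    (h₁.mono (by simp [hD, sup_assoc]))
    (h₂.mono (by rw [hD]; exact le_sup_of_le_left (le_sup_of_le_left
      (le_sup_of_le_left le_sup_right))))
    (h₃.mono (by rw [hD]; exact le_sup_of_le_left (le_sup_of_le_left le_sup_right)))
    (h₄.mono (by rw [hD]; exact le_sup_of_le_left le_sup_right))
    (h₅.mono (by rw [hD]; exact le_sup_right))
  exact ⟨_, hd, ⟨σ, μ, hμ, hbij, ⟨D, hD, cμ⟩, ⟨D, hD, cσ⟩⟩, hext⟩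

theorem exists_gsl_of_degree (d : Degree) (φ : latticeOfDegree hV d ≃o latticeOfDegree hV d) :
    ∃ e ≤ d, ∃ g : GSL F V e, Extends g.orderIso φ := by
  -- The type of `φ` mentions the lattice being rewritten.
  revert φ
  rw [← latticeOfIdeal_principal]
  intro φ
  obtain ⟨e, he, g, hg⟩ := exists_gsl_of_ideal hV (TuringIdeal.principal d) φ
  exact ⟨e, TuringIdeal.mem_principal.1 he, g, hg⟩

theorem GSL.orderIso_mem_autExt_degree {d e : Degree} (g : GSL F V e) (he : e ≤ d) :
    g.orderIso ∈ autExt (latticeOfDegree hV d) :=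
  mem_autExt_of_forall_mem_iff fun W => g.dEnumerable_orderIso_iff he W

/-- A subspace enumerable in `d` is moved, in either direction, to one enumerable in `d ⊔ e`, which
is still in `I`. -/
theorem GSL.orderIso_mem_autExt_ideal {I : TuringIdeal} {e : Degree} (g : GSL F V e)
    (he : e ∈ I) : g.orderIso ∈ autExt (latticeOfIdeal hV I) :=
  mem_autExt_of_forall_mem_iff fun W =>
    ⟨fun ⟨d, hd, h⟩ => ⟨d ⊔ e, I.sup_mem d hd e he,
      (g.dEnumerable_orderIso_iff le_sup_right W).1 (h.mono le_sup_left)⟩,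
    fun ⟨d, hd, h⟩ => ⟨d ⊔ e, I.sup_mem d hd e he,
      (g.dEnumerable_orderIso_iff le_sup_right W).2 (h.mono le_sup_left)⟩⟩

/-- Every automorphism of the lattice of all subspaces is induced by a semilinear bijection that
is computable in some degree. -/
theorem exists_gsl (hV : IsComputableVectorSpace F V) (Φ : Submodule F V ≃o Submodule F V) :
    ∃ (d : Degree) (g : GSL F V d), Φ = g.orderIso := by
  obtain ⟨φ, hφ⟩ : Φ ∈ autExt (latticeOfIdeal hV TuringIdeal.all) :=
    mem_autExt_of_forall_mem_iff fun W =>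
      iff_of_true (mem_latticeOfIdeal_all hV _) (mem_latticeOfIdeal_all hV _)
  obtain ⟨d, -, g, hg⟩ := exists_gsl_of_ideal hV _ φ
  exact ⟨d, g, hφ.unique (span_singleton_mem_latticeOfIdeal hV _) hg⟩

end Main

end Automorphisms

end TuringAut

theorem mainTheorem6 {F V : Type*} [Field F] [Primcodable F] [AddCommGroup V] [Module F V]
    [Primcodable V] (hF : TuringAut.IsComputableField F)
    (hV : TuringAut.IsComputableVectorSpace F V) :
    -- Automorphisms of the lattices extend uniquely to the lattice of all subspaces.
    (∀ (I : TuringAut.TuringIdeal)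
        (φ : TuringAut.latticeOfIdeal hV I ≃o TuringAut.latticeOfIdeal hV I),
      ∃! Φ : Submodule F V ≃o Submodule F V, TuringAut.Extends Φ φ) ∧
    (∀ (d : TuringAut.Degree)
        (φ : TuringAut.latticeOfDegree hV d ≃o TuringAut.latticeOfDegree hV d),
      ∃! Φ : Submodule F V ≃o Submodule F V, TuringAut.Extends Φ φ) ∧
    -- Part (a).
    (∀ I : TuringAut.TuringIdeal,
      TuringAut.autExt (TuringAut.latticeOfIdeal hV I) =
        ⋃ d ∈ I, TuringAut.autExt (TuringAut.latticeOfDegree hV d)) ∧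
    -- Part (b).
    ((Set.univ : Set (Submodule F V ≃o Submodule F V)) =
        ⋃ d : TuringAut.Degree, TuringAut.autExt (TuringAut.latticeOfDegree hV d)) ∧
    -- Each automorphism is induced by a computable semilinear transformation.
    (∀ (I : TuringAut.TuringIdeal)
        (φ : TuringAut.latticeOfIdeal hV I ≃o TuringAut.latticeOfIdeal hV I),
      ∃ d ∈ I, ∃ g : TuringAut.GSL F V d, ∀ W : TuringAut.latticeOfIdeal hV I,
        ((φ W : Submodule F V) : Set V) = g.μ '' ((W : Submodule F V) : Set V)) ∧
    (∀ Φ : Submodule F V ≃o Submodule F V,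
      ∃ (d : TuringAut.Degree) (g : TuringAut.GSL F V d), ∀ W : Submodule F V,
        ((Φ W : Submodule F V) : Set V) = g.μ '' (W : Set V)) := by
  refine ⟨fun I φ => ?_, fun d φ => ?_, fun I => ?_, ?_, fun I φ => ?_, fun Φ => ?_⟩
  · obtain ⟨d, -, g, hg⟩ := TuringAut.exists_gsl_of_ideal hV I φ
    exact ⟨g.orderIso, hg, fun Ψ hΨ =>
      hΨ.unique (TuringAut.span_singleton_mem_latticeOfIdeal hV I) hg⟩
  · obtain ⟨e, -, g, hg⟩ := TuringAut.exists_gsl_of_degree hV d φ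
    exact ⟨g.orderIso, hg, fun Ψ hΨ =>
      hΨ.unique (TuringAut.span_singleton_mem_latticeOfDegree hV d) hg⟩
  · ext Φ
    simp only [Set.mem_iUnion, exists_prop]
    constructor
    · rintro ⟨φ, hφ⟩
      obtain ⟨d, hd, g, hg⟩ := TuringAut.exists_gsl_of_ideal hV I φ
      rw [hφ.unique (TuringAut.span_singleton_mem_latticeOfIdeal hV I) hg]
      exact ⟨d, hd, g.orderIso_mem_autExt_degree hV le_rfl⟩
    -- The semilinear map is computable in some `e ≤ d`; downward closure puts `e` in `I`.
    · rintro ⟨d, hd, φ, hφ⟩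
      obtain ⟨e, he, g, hg⟩ := TuringAut.exists_gsl_of_degree hV d φ
      rw [hφ.unique (TuringAut.span_singleton_mem_latticeOfDegree hV d) hg]
      exact g.orderIso_mem_autExt_ideal hV (I.lower d hd e he)
  · ext Φ
    simp only [Set.mem_univ, Set.mem_iUnion, true_iff]
    obtain ⟨d, g, rfl⟩ := TuringAut.exists_gsl hV Φ
    exact ⟨d, g.orderIso_mem_autExt_degree hV le_rfl⟩
  · obtain ⟨d, hd, g, hg⟩ := TuringAut.exists_gsl_of_ideal hV I φ
    exact ⟨d, hd, g, fun W => by rw [← hg W, g.coe_orderIso]⟩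
  · obtain ⟨d, g, rfl⟩ := TuringAut.exists_gsl hV Φ
    exact ⟨d, g, g.coe_orderIso⟩
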